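/- Let $\Bbbk$ be a field of characteristic zero, $t\in\Bbbk$, and $T=e^{ht}\in\Bbbk[[h]]$. Let $A_1$ be the Weyl–Heisenberg algebra over $\Bbbk$ with generators $\mathbf x,\mathbf p$ and relation $\mathbf p\mathbf x-\mathbf x\mathbf p=1$, let $A_n=A_1^{\otimes n}$ with generators $\mathbf x_i,\mathbf p_i$, and consider their $h$-adic deformations $A_n[[h]]$. Let $\mathcal N$ be the normal ordering map, i.e. the $\Bbbk$-linear map, extended coefficientwise in $h$, with $\mathcal N(\prod_i x_i^{\alpha_i}p_i^{\beta_i})=\prod_i\mathbf x_i^{\alpha_i}\prod_i\mathbf p_i^{\beta_i}$. Put $\mathcal A_n=\exp(h\,\mathrm{Mat}_n(\Bbbk[[h]]))$ and, for $Q\in\mathcal A_n$, $\varphi(Q)=\mathcal N(\exp(x^{\top}(Q-\mathbf 1)p))\in A_n[[h]]$. Set $$R=\varphi\begin{pmatrix}T&0\\1-T^2&T\end{pmatrix}\in (A_1\otimes A_1)[[h]],\qquad \kappa=1 .$$ Let $\mathcal K$ be a long knot, and let $D$ be an upward diagram of $\mathcal K$: it begins and ends with an upward strand and both strands are oriented upward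 at every crossing. Number the edges of $D$ (the arcs between consecutive passages through crossings) consecutively along the orientation, and let $i^+=i+1$. For a crossing $c$ let $s=\pm1$ be its sign, and let $i$ and $j$ be the incoming edges of its over- and under-strand. *Universal invariant.* Put $R^{s}$ at every crossing, with the first tensor factor on the edge $i$ and the second one on the edge $j$, and $\kappa^{\pm1}$ for each full counterclockwise (resp. clockwise) turn of an edge. Multiplying these labels from right to left along the knot gives $Z\in A_1[[h]]$. Let $\widetilde{\mathcal K}$ be the closed knot obtained from $\mathcal K$ by trivially closing its open component; the element $Z$ is taken as the universal invariant $Z_{\mathscr A}(\widetilde{\mathcal K})$, where $\mathscr A=(A_1,R,\kappa)$. A scalar part of $Z$ is an $\omega\in\Bbbk[[h]]$ with $Z=\omega\cdot\varphi(Q)$ for some $Q\in\mathcal A_1$. *Alexander polynomial.* Let $A=I+\sum_c A_c$, where the rows and columns are indexed by the edges of $D$ and the only nonzero contributions of $A_c$ are $-T^s$ at $(i,i^+)$, $T^s-1$ at $(i,j^+)$ and $-1$ at $(j,j^+)$. Let $\Delta_{\widetilde{\mathcal K}}(T)=\det A\in\mathbb Z[T^{\pm1}]$; as an invariant of $\widetilde{\mathcal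 K}$ it is defined up to units $\pm T^m$. **Theorem.** For every long knot $\mathcal K$ and every upward diagram $D$ of $\mathcal K$, the element $Z$ has exactly one scalar part $\omega$, and $$\omega\cdot\Delta_{\widetilde{\mathcal K}}(T^2)=\pm T^{n}\quad\text{for some } n\in\mathbb Z \text{ and some sign},$$ that is, $\omega$ is the inverse $\Delta_{\widetilde{\mathcal K}}(T^2)^{-1}$ of the Alexander polynomial evaluated at $T^2$, up to a unit $\pm T^n$. -/

import Mathlib

open scoped TensorProduct Nat
open PowerSeries (X)

noncomputable section

/-! ### Upward diagrams of long knots -/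

/-- A point in which a generic horizontal line meets a partially drawn diagram.
`edge` is the running index of the edge that passes through it (edges are the arcs between
consecutive passages through crossings, numbered `0, 1, 2, …` along the orientation), `turn` is
the number of local maxima and minima that the strand has met since it entered this edge, and `up`
tells whether the strand is oriented upward there. -/
structure Strand where
  edge : ℕ
  turn : ℕ
  up : Bool

/-- `UpwardTangle w` is the type of (Morse presentations of) the parts of an upward long knot
diagram that lie below a horizontal line, where `w` lists, from left to right, the points in which
the diagram meets the line.  A diagram starts with a single upward strand and is drawn from bottom
to top, one crossing, maximum or minimum at a time.  Both strands are oriented upward at each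
crossing.  The pair `(edge, turn)` increases lexicographically along the orientation at each
crossing, maximum and minimum, so no closed component can occur. -/
inductive UpwardTangle : List Strand → Type
  /-- The initial upward strand. -/
  | start : UpwardTangle [⟨0, 0, true⟩]
  /-- A crossing of two upward strands.  The incoming edges are `a` (lower left) and `b` (lower
  right), the outgoing ones are `b + 1` (upper left) and `a + 1` (upper right).  The crossing is
  positive, that is, the strand from the lower left to the upper right is the over-strand, if
  `pos` is `true`; otherwise it is negative and that strand is the under-strand. -/
  | crossing (pos : Bool) {l r : List Strand} {a b u v : ℕ}
      (d : UpwardTangle (l ++ ⟨a, u, true⟩ :: ⟨b, v, true⟩ :: r)) :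
      UpwardTangle (l ++ ⟨b + 1, 0, true⟩ :: ⟨a + 1, 0, true⟩ :: r)
  /-- A maximum run through from right to left: a counterclockwise half turn. -/
  | maxLeft {l r : List Strand} {a u : ℕ}
      (d : UpwardTangle (l ++ ⟨a, u + 1, false⟩ :: ⟨a, u, true⟩ :: r)) :
      UpwardTangle (l ++ r)
  /-- A maximum run through from left to right: a clockwise half turn. -/
  | maxRight {l r : List Strand} {a u : ℕ}
      (d : UpwardTangle (l ++ ⟨a, u, true⟩ :: ⟨a, u + 1, false⟩ :: r)) :
      UpwardTangle (l ++ r)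
  /-- A minimum run through from left to right: a counterclockwise half turn. -/
  | minRight {l r : List Strand} (a u : ℕ) (d : UpwardTangle (l ++ r)) :
      UpwardTangle (l ++ ⟨a, u, false⟩ :: ⟨a, u + 1, true⟩ :: r)
  /-- A minimum run through from right to left: a clockwise half turn. -/
  | minLeft {l r : List Strand} (a u : ℕ) (d : UpwardTangle (l ++ r)) :
      UpwardTangle (l ++ ⟨a, u + 1, true⟩ :: ⟨a, u, false⟩ :: r)

/-- A crossing: its sign, and the incoming edges of its over-strand and of its under-strand. -/
structure Crossing where
  pos : Bool
  overEdge : ℕ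
  underEdge : ℕ

/-- The sign `s = ±1` of a crossing. -/
def Crossing.sign (c : Crossing) : ℤ := if c.pos then 1 else -1

namespace UpwardTangle

/-- The list of crossings of a diagram. -/
def crossings : {w : List Strand} → UpwardTangle w → List Crossing
  | _, start => []
  | _, @crossing pos _ _ a b _ _ d =>
      (if pos then ⟨pos, a, b⟩ else ⟨pos, b, a⟩) :: crossings d
  | _, maxLeft d => crossings d
  | _, maxRight d => crossings d
  | _, minRight _ _ d => crossings d
  | _, minLeft _ _ d => crossings d

/-- The number of counterclockwise half turns minus the number of clockwise half turns of the
edge `e`. -/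
def halfTurns (e : ℕ) : {w : List Strand} → UpwardTangle w → ℤ
  | _, start => 0
  | _, crossing _ d => halfTurns e d
  | _, @maxLeft _ _ a _ d => halfTurns e d + if a = e then 1 else 0
  | _, @maxRight _ _ a _ d => halfTurns e d - if a = e then 1 else 0
  | _, minRight a _ d => halfTurns e d + if a = e then 1 else 0
  | _, minLeft a _ d => halfTurns e d - if a = e then 1 else 0

end UpwardTangle

/-- An upward diagram of a long knot: an upward tangle diagram that starts and ends with a single
upward strand.  Its edges are `0, 1, …, lastEdge`; if it has `n` crossings, then
`lastEdge = 2 * n`. -/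
structure UpwardKnotDiagram where
  lastEdge : ℕ
  lastTurn : ℕ
  tangle : UpwardTangle [⟨lastEdge, lastTurn, true⟩]

/-! ### The Alexander polynomial -/

namespace UpwardKnotDiagram

variable (D : UpwardKnotDiagram)

/-- The set of edges of `D`. -/
abbrev Edge : Type := Fin (D.lastEdge + 1)

/-- The edge with running index `e`, for `e ≤ D.lastEdge`. -/
def edge (e : ℕ) : D.Edge := Fin.ofNat (D.lastEdge + 1) e

open LaurentPolynomial in
/-- The contribution `A_c` of a crossing `c` with over-strand `i → i⁺ = i + 1` and under-strand
`j → j⁺ = j + 1`: the entries are `-T ^ s` at `(i, i⁺)`, `T ^ s - 1` at `(i, j⁺)`, `-1` at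
`(j, j⁺)`, and zero elsewhere. -/
def crossingMatrix (c : Crossing) : Matrix D.Edge D.Edge (LaurentPolynomial ℤ) :=
  Matrix.single (D.edge c.overEdge) (D.edge (c.overEdge + 1)) (-T c.sign) +
  Matrix.single (D.edge c.overEdge) (D.edge (c.underEdge + 1)) (T c.sign - 1) +
  Matrix.single (D.edge c.underEdge) (D.edge (c.underEdge + 1)) (-1)

/-- The Alexander matrix `A = I + ∑ A_c`, the sum being over all crossings. -/
def alexanderMatrix : Matrix D.Edge D.Edge (LaurentPolynomial ℤ) :=
  1 + (D.tangle.crossings.map D.crossingMatrix).sum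

/-- The Alexander polynomial computed from the diagram `D` (as a knot invariant, it is defined up
to units `± T ^ m`). -/
def alexanderPolynomial : LaurentPolynomial ℤ := D.alexanderMatrix.det

end UpwardKnotDiagram

/-! ### Tensor legs, contraction and the universal invariant

For a `k`-algebra `B`, the (topological) trivial deformation of `B` over `k⟦h⟧` is `B⟦X⟧`, where
`X` plays the role of `h`; `k`-linear maps are applied to it coefficientwise. -/

section UniversalInvariant

variable {k : Type*} [Field k]

/-- The `h`-linear extension of a linear map to the trivial deformations. -/
def deform {V W : Type*} [Ring V] [Algebra k V] [Ring W] [Algebra k W]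
    (f : V →ₗ[k] W) (z : PowerSeries V) : PowerSeries W :=
  PowerSeries.mk fun d => f (PowerSeries.coeff d z)

variable {A : Type*} [Ring A] [Algebra k A]

/-- The placement of a two-fold tensor on the legs `i` (first factor) and `j` (second factor) of
`A^{⊗ I}`, with `1` on all other legs, for `i ≠ j`. -/
def placeLegs {I : Type*} [DecidableEq I] (i j : I) :
    (⨂[k] _ : Fin 2, A) →ₗ[k] (⨂[k] _ : I, A) :=
  PiTensorProduct.lift
    ((MultilinearMap.mkPiAlgebraFin k 2 (⨂[k] _ : I, A)).compLinearMap
      ![(PiTensorProduct.singleAlgHom (R := k) (A := fun _ : I => A) i).toLinearMap,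
        (PiTensorProduct.singleAlgHom (R := k) (A := fun _ : I => A) j).toLinearMap])

/-- The contraction `a₀ ⊗ a₁ ⊗ ⋯ ⊗ aₘ ↦ aₘ ⋯ a₁ a₀` of all legs, which multiplies the legs from
right to left. For `n = 1` this is the canonical isomorphism from `A^{⊗ 1}` to `A`. -/
def contractLegs (n : ℕ) : (⨂[k] _ : Fin n, A) →ₗ[k] A :=
  PiTensorProduct.lift
    ((MultilinearMap.mkPiAlgebraFin k n A).domDomCongr (Fin.revPerm : Equiv.Perm (Fin n)))

namespace UpwardKnotDiagram

variable (D : UpwardKnotDiagram)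

/-- The bead of a crossing: `R` for a positive and `R⁻¹` for a negative crossing, with the first
tensor factor on the incoming edge of the over-strand and the second one on the incoming edge of
the under-strand. -/
def crossingBead (R : (PowerSeries (⨂[k] _ : Fin 2, A))ˣ) (c : Crossing) :
    PowerSeries (⨂[k] _ : D.Edge, A) :=
  deform (placeLegs (k := k) (A := A) (D.edge c.overEdge) (D.edge c.underEdge))
    ((R ^ c.sign : (PowerSeries (⨂[k] _ : Fin 2, A))ˣ) : PowerSeries (⨂[k] _ : Fin 2, A))

/-- The bead `κ ^ r` of an edge, where `r` is the number of its full counterclockwise turns. -/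
def turnBead (κ : (PowerSeries A)ˣ) (e : D.Edge) : PowerSeries (⨂[k] _ : D.Edge, A) :=
  deform (PiTensorProduct.singleAlgHom (R := k) (A := fun _ : D.Edge => A) e).toLinearMap
    ((κ ^ (D.tangle.halfTurns e / 2) : (PowerSeries A)ˣ) : PowerSeries A)

/-- The universal invariant of (the diagram `D` of) a long knot with respect to the algebra `A`
(deformed over `k⟦h⟧`) and the elements `R` and `κ`: the labels of the beads that are met when one
traverses the knot, multiplied from right to left.  On each edge, the bead of its turns comes
before the bead of the crossing at which it ends. -/
def universalInvariant (R : (PowerSeries (⨂[k] _ : Fin 2, A))ˣ) (κ : (PowerSeries A)ˣ) :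
    PowerSeries A :=
  deform (contractLegs (k := k) (A := A) (D.lastEdge + 1))
    ((D.tangle.crossings.map (D.crossingBead R)).prod *
      (List.ofFn (D.turnBead (k := k) κ)).prod)

end UpwardKnotDiagram

end UniversalInvariant

/-! ### The Weyl–Heisenberg algebra -/

section Heisenberg

/-- The two generators `x` and `p`. -/
inductive HeisenbergGen : Type
  | x
  | p

/-- The defining relation `p x - x p = 1`. -/
inductive HeisenbergRel (k : Type*) [Field k] :
    FreeAlgebra k HeisenbergGen → FreeAlgebra k HeisenbergGen → Prop
  | comm : HeisenbergRel k
      (FreeAlgebra.ι k HeisenbergGen.p * FreeAlgebra.ι k HeisenbergGen.x -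
        FreeAlgebra.ι k HeisenbergGen.x * FreeAlgebra.ι k HeisenbergGen.p) 1

/-- The Weyl–Heisenberg algebra in one pair of generators. The algebra in `n` pairs of generators
is its `n`-th tensor power. -/
abbrev Heisenberg (k : Type*) [Field k] : Type _ := RingQuot (HeisenbergRel k)

/-- The `n`-th Weyl–Heisenberg algebra `A_n`, as the `n`-th tensor power of `A_1`. -/
abbrev HeisenbergPow (k : Type*) [Field k] (n : ℕ) : Type _ := ⨂[k] _ : Fin n, Heisenberg k

variable {k : Type*} [Field k]

/-- The generators of the Weyl–Heisenberg algebra. -/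
def heisenbergGen (g : HeisenbergGen) : Heisenberg k :=
  RingQuot.mkAlgHom k (HeisenbergRel k) (FreeAlgebra.ι k g)

/-- The normal ordering map, which sends the monomial `∏ x_i ^ α_i p_i ^ β_i` to the tensor product
of the `x ^ α_i p ^ β_i`. The variable `x_i` is `Sum.inl i`, and `p_i` is `Sum.inr i`. -/
def normalOrder (n : ℕ) : MvPolynomial (Fin n ⊕ Fin n) k →ₗ[k] HeisenbergPow k n :=
  (MvPolynomial.basisMonomials (Fin n ⊕ Fin n) k).constr k fun m =>
    PiTensorProduct.tprod k fun i =>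
      heisenbergGen .x ^ m (Sum.inl i) * heisenbergGen .p ^ m (Sum.inr i)

/-- The exponential series `exp f = ∑ f ^ m / m!` of a power series `f` in `h` with constant term
zero; since `f ^ m` is divisible by `h ^ m`, the terms with `m > d` do not contribute to the
coefficient of `h ^ d`. -/
def hexp {B : Type*} [Ring B] [Algebra k B] (f : PowerSeries B) : PowerSeries B :=
  PowerSeries.mk fun d =>
    ∑ m ∈ Finset.range (d + 1), ((m ! : k)⁻¹) • PowerSeries.coeff d (f ^ m)

/-- The exponential of a matrix over `k⟦h⟧` with entries divisible by `h`. -/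
def matrixExp {n : ℕ} (M : Matrix (Fin n) (Fin n) (PowerSeries k)) :
    Matrix (Fin n) (Fin n) (PowerSeries k) :=
  Matrix.of fun i j => PowerSeries.mk fun d =>
    ∑ m ∈ Finset.range (d + 1), ((m ! : k)⁻¹) • PowerSeries.coeff d ((M ^ m) i j)

/-- The set `𝒜_n = exp (h Mat_n (k⟦h⟧))`. -/
def expMatrices (k : Type*) [Field k] (n : ℕ) : Set (Matrix (Fin n) (Fin n) (PowerSeries k)) :=
  {Q | ∃ B : Matrix (Fin n) (Fin n) (PowerSeries k), Q = matrixExp ((X : PowerSeries k) • B)}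

/-- The quadratic form `xᵀ M p`. -/
def quadraticForm {n : ℕ} (M : Matrix (Fin n) (Fin n) (PowerSeries k)) :
    PowerSeries (MvPolynomial (Fin n ⊕ Fin n) k) :=
  ∑ i, ∑ j, PowerSeries.map MvPolynomial.C (M i j) *
    PowerSeries.C (MvPolynomial.X (Sum.inl i) * MvPolynomial.X (Sum.inr j))

/-- The map `φ(Q) = 𝒩 (exp (xᵀ (Q - 1) p))`, for `Q` congruent to `1` modulo `h`. -/
def gaussian {n : ℕ} (Q : Matrix (Fin n) (Fin n) (PowerSeries k)) :
    PowerSeries (HeisenbergPow k n) :=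
  deform (normalOrder n) (hexp (k := k) (quadraticForm (Q - 1)))

/-- `ω` is a scalar part of `Z`: one has `Z = ω · φ(Q)` for some `Q` in `𝒜_1`. -/
def IsScalarPart (Z : PowerSeries (Heisenberg k)) (ω : PowerSeries k) : Prop :=
  ∃ Q ∈ expMatrices k 1,
    Z = PowerSeries.map (algebraMap k (Heisenberg k)) ω * deform (contractLegs 1) (gaussian Q)

theorem constantCoeff_gaussian {n : ℕ} (Q : Matrix (Fin n) (Fin n) (PowerSeries k)) :
    PowerSeries.constantCoeff (gaussian Q) = 1 := by
  have h : PowerSeries.constantCoeff (gaussian Q) =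
      normalOrder n (PowerSeries.coeff 0 (hexp (k := k) (quadraticForm (Q - 1)))) := by
    rw [← PowerSeries.coeff_zero_eq_constantCoeff_apply, gaussian, deform, PowerSeries.coeff_mk]
  have h1 : (1 : MvPolynomial (Fin n ⊕ Fin n) k) =
      MvPolynomial.basisMonomials (Fin n ⊕ Fin n) k 0 := by
    simp
  rw [h]
  simp only [hexp, PowerSeries.coeff_mk, zero_add, Finset.sum_range_one, pow_zero,
    Nat.factorial_zero, Nat.cast_one, inv_one, one_smul, PowerSeries.coeff_zero_one]
  rw [h1, normalOrder, Module.Basis.constr_basis]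
  simp only [Finsupp.coe_zero, Pi.zero_apply, pow_zero, mul_one]
  rfl

/-- `φ(Q)` as an invertible element. -/
def gaussianUnit {n : ℕ} (Q : Matrix (Fin n) (Fin n) (PowerSeries k)) :
    (PowerSeries (HeisenbergPow k n))ˣ where
  val := gaussian Q
  inv := PowerSeries.invOfUnit (gaussian Q) 1
  val_inv := PowerSeries.mul_invOfUnit _ _ (constantCoeff_gaussian Q)
  inv_val := PowerSeries.invOfUnit_mul _ _ (constantCoeff_gaussian Q)

variable [CharZero k]

/-- The invertible power series `T = e ^ (h t)`. -/
def expT (t : k) : (PowerSeries k)ˣ where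
  val := PowerSeries.rescale t (PowerSeries.exp k)
  inv := PowerSeries.rescale (-t) (PowerSeries.exp k)
  val_inv := by
    rw [PowerSeries.exp_mul_exp_eq_exp_add, add_neg_cancel, PowerSeries.rescale_zero_apply]
    simp
  inv_val := by
    rw [PowerSeries.exp_mul_exp_eq_exp_add, neg_add_cancel, PowerSeries.rescale_zero_apply]
    simp

/-- The element `R = φ(M)` with `M = [[T, 0], [1 - T², T]]`. -/
def heisenbergR (t : k) : (PowerSeries (HeisenbergPow k 2))ˣ :=
  gaussianUnit !![(expT t : PowerSeries k), 0; 1 - (expT t : PowerSeries k) ^ 2, expT t]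

end Heisenberg

end

/-! The element φ(Q) is determined by how it moves past the generators: b x_i = ∑ Q_ji x_j b and p_i
b = ∑ Q_ij b p_j, together with b' = ∑ Q'_ij x_i b p_j for the derivative in h. These relations
(`IsGaussian`) pass to products and inverses, with Q multiplied and inverted accordingly. Hence the
product G of all beads, before the legs are contracted, is Gaussian with an explicit matrix Q.
Different crossings have different incoming edges, so Q is 1 plus a sum over the crossings.

Contraction glues the left end of leg e to the right end of leg e + 1. If S is the shift matrix of e
→ e + 1, the gluing is governed by B = 1 - QᵀS. Let Z be the contraction of G and ω its vacuum
expectation value. Moving generators around the contracted word expresses ω' through ω and B; by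
Jacobi's formula (ω det B)' = 0, so ω det B = 1 (`functional_mul_det`).

The matrix B is the Alexander matrix at T² up to conjugation by the diagonal matrix of the T^μ(e),
where μ(e) is the Alexander number of the region to the left of edge e (`exists_regions`,
`alexanderMatrix_map_evalSq`). So det B = Δ(T²) for the determinant of the given diagram, without
any unit.

That Z is a scalar comes from the row sums of the Alexander matrix, which vanish except in the last
row. For B this gives a vector e with e_0 = 1 and B e equal to the last basis vector, and it forces
Z to commute with x and p (`commute_x`, `commute_p`). In characteristic zero the center of the Weyl
algebra is k, so Z = ω. The scalar part is unique because every φ(Q) has vacuum expectation value 1.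
-/

noncomputable section

/-! ### Power series over noncommutative algebras -/

section PowerSeriesAlgebra

variable {k : Type*} [Field k]

/-- The trivial deformation `B⟦h⟧` of a `k`-algebra `B` is an algebra over `k⟦h⟧`. -/
instance deformationAlgebra {B : Type*} [Ring B] [Algebra k B] :
    Algebra (PowerSeries k) (PowerSeries B) :=
  (PowerSeries.map (algebraMap k B)).toAlgebra' fun c z => by
    ext n
    simp only [PowerSeries.coeff_mul, PowerSeries.coeff_map]
    rw [← Finset.Nat.sum_antidiagonal_swap]
    exact Finset.sum_congr rfl fun _ _ => Algebra.commutes _ _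

section

variable {B : Type*} [Ring B] [Algebra k B]

theorem smul_eq_map_mul (c : PowerSeries k) (z : PowerSeries B) :
    c • z = PowerSeries.map (algebraMap k B) c * z := rfl

theorem coeff_smul_powerSeries (c : PowerSeries k) (z : PowerSeries B) (n : ℕ) :
    PowerSeries.coeff n (c • z) =
      ∑ q ∈ Finset.HasAntidiagonal.antidiagonal n, PowerSeries.coeff q.1 c • PowerSeries.coeff q.2 z := by
  rw [smul_eq_map_mul, PowerSeries.coeff_mul]
  simp only [PowerSeries.coeff_map, Algebra.smul_def]

/-- The derivative with respect to `h`. -/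
def hderiv (z : PowerSeries B) : PowerSeries B :=
  PowerSeries.mk fun n => (n + 1) • PowerSeries.coeff (n + 1) z

theorem coeff_hderiv (z : PowerSeries B) (n : ℕ) :
    PowerSeries.coeff n (hderiv z) = (n + 1) • PowerSeries.coeff (n + 1) z := by
  simp [hderiv]

theorem hderiv_C (b : B) : hderiv (PowerSeries.C b) = 0 := by
  ext n
  simp [coeff_hderiv]

theorem hderiv_one : hderiv (1 : PowerSeries B) = 0 := by
  simpa using hderiv_C (1 : B)

theorem hderiv_mul (y z : PowerSeries B) : hderiv (y * z) = hderiv y * z + y * hderiv z := by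
  ext n
  -- On the antidiagonal n + 1 = q.1 + q.2, which distributes the weight over the two factors
  -- without commuting them.
  have h : (n + 1) • PowerSeries.coeff (n + 1) (y * z) =
      ∑ q ∈ Finset.HasAntidiagonal.antidiagonal (n + 1),
        (q.1 • PowerSeries.coeff q.1 y * PowerSeries.coeff q.2 z +
          PowerSeries.coeff q.1 y * q.2 • PowerSeries.coeff q.2 z) := by
    rw [PowerSeries.coeff_mul, Finset.smul_sum]
    refine Finset.sum_congr rfl fun q hq => ?_
    rw [← Finset.HasAntidiagonal.mem_antidiagonal.1 hq, add_smul, smul_mul_assoc, mul_smul_comm]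
  rw [coeff_hderiv, h, Finset.sum_add_distrib, map_add, PowerSeries.coeff_mul,
    PowerSeries.coeff_mul]
  congr 1
  · rw [Finset.Nat.sum_antidiagonal_succ]
    simp [coeff_hderiv]
  · rw [Finset.Nat.sum_antidiagonal_succ']
    simp [coeff_hderiv]

theorem hderiv_smul (c : PowerSeries k) (z : PowerSeries B) :
    hderiv (c • z) = PowerSeries.derivative k c • z + c • hderiv z := by
  rw [smul_eq_map_mul, hderiv_mul, smul_eq_map_mul, smul_eq_map_mul]
  congr 2
  ext n
  simp [coeff_hderiv, PowerSeries.coeff_derivative, nsmul_eq_mul, mul_comm]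

end

section

variable {V W : Type*} [Ring V] [Algebra k V] [Ring W] [Algebra k W]

theorem coeff_deform (f : V →ₗ[k] W) (z : PowerSeries V) (n : ℕ) :
    PowerSeries.coeff n (deform f z) = f (PowerSeries.coeff n z) := by
  simp [deform]

theorem deform_add (f : V →ₗ[k] W) (y z : PowerSeries V) :
    deform f (y + z) = deform f y + deform f z := by
  ext n; simp [coeff_deform]

theorem deform_sum (f : V →ₗ[k] W) {ι : Type*} (s : Finset ι) (z : ι → PowerSeries V) :
    deform f (∑ i ∈ s, z i) = ∑ i ∈ s, deform f (z i) := by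
  ext n; simp [coeff_deform]

theorem deform_smul (f : V →ₗ[k] W) (c : PowerSeries k) (z : PowerSeries V) :
    deform f (c • z) = c • deform f z := by
  ext n; simp [coeff_deform, coeff_smul_powerSeries]

theorem deform_functional_smul (f : V →ₗ[k] k) (c : PowerSeries k) (z : PowerSeries V) :
    deform f (c • z) = c * deform f z := by
  ext n; simp [coeff_deform, coeff_smul_powerSeries, PowerSeries.coeff_mul]

theorem deform_hderiv (f : V →ₗ[k] W) (z : PowerSeries V) :
    deform f (hderiv z) = hderiv (deform f z) := by
  ext n; rw [coeff_deform, coeff_hderiv, coeff_hderiv, coeff_deform, map_nsmul]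

theorem deform_C (f : V →ₗ[k] W) (a : V) :
    deform f (PowerSeries.C a) = PowerSeries.C (f a) := by
  ext n
  rw [coeff_deform, PowerSeries.coeff_C, PowerSeries.coeff_C]
  split_ifs <;> simp

theorem deform_algHom (f : V →ₐ[k] W) (z : PowerSeries V) :
    deform f.toLinearMap z = PowerSeries.map (f : V →+* W) z := by
  ext n; simp [coeff_deform]

end

end PowerSeriesAlgebra

/-! ### Gaussian elements -/

section GaussianElements

variable {k : Type*} [Field k]

theorem derivative_matrix_mul_apply {ι : Type*} [Fintype ι]
    (P Q : Matrix ι ι (PowerSeries k)) (i j : ι) :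
    PowerSeries.derivative k ((P * Q) i j) =
      ∑ l, (PowerSeries.derivative k (P i l) * Q l j + P i l * PowerSeries.derivative k (Q l j)) := by
  rw [Matrix.mul_apply, map_sum]
  refine Finset.sum_congr rfl fun l _ => ?_
  rw [Derivation.leibniz, smul_eq_mul, smul_eq_mul]
  ring

/-- `b` satisfies the commutation relations and the differential equation that characterize the
normally ordered exponential of `xᵀ (Q - 1) p`, for given families `x` and `p` in `B`. -/
structure IsGaussian {B : Type*} [Ring B] [Algebra k B] {ι : Type*} [Fintype ι] [DecidableEq ι]
    (x p : ι → B) (b : PowerSeries B) (Q : Matrix ι ι (PowerSeries k)) : Prop where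
  constantCoeff_eq : PowerSeries.constantCoeff b = 1
  constantCoeff_matrix : Q.map PowerSeries.constantCoeff = 1
  mul_x : ∀ i, b * PowerSeries.C (x i) = ∑ j, Q j i • (PowerSeries.C (x j) * b)
  p_mul : ∀ i, PowerSeries.C (p i) * b = ∑ j, Q i j • (b * PowerSeries.C (p j))
  hderiv_eq : hderiv b = ∑ i, ∑ j, PowerSeries.derivative k (Q i j) •
    (PowerSeries.C (x i) * b * PowerSeries.C (p j))

variable {B : Type*} [Ring B] [Algebra k B] {ι : Type*} [Fintype ι] [DecidableEq ι] {x p : ι → B}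

namespace IsGaussian

theorem one : IsGaussian (k := k) x p 1 1 where
  constantCoeff_eq := by simp
  constantCoeff_matrix := Matrix.map_one _ (map_zero _) (map_one _)
  mul_x i := by simp [Matrix.one_apply]
  p_mul i := by simp [Matrix.one_apply]
  hderiv_eq := by
    rw [hderiv_one, eq_comm]
    refine Finset.sum_eq_zero fun i _ => Finset.sum_eq_zero fun j _ => ?_
    rw [Matrix.one_apply]
    split_ifs <;> simp

/-- A generator x passes b₂ and then b₁, a generator p passes b₁ and then b₂. In b₁' b₂ the p's are
moved right past b₂, in b₁ b₂' the x's are moved left past b₁; the two results are the two halves of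
(Q₁ Q₂)'. No formula for a product of normally ordered exponentials is needed. -/
theorem mul {b₁ b₂ : PowerSeries B} {Q₁ Q₂ : Matrix ι ι (PowerSeries k)}
    (h₁ : IsGaussian x p b₁ Q₁) (h₂ : IsGaussian x p b₂ Q₂) :
    IsGaussian x p (b₁ * b₂) (Q₁ * Q₂) where
  constantCoeff_eq := by rw [map_mul, h₁.constantCoeff_eq, h₂.constantCoeff_eq, one_mul]
  constantCoeff_matrix := by
    rw [Matrix.map_mul, h₁.constantCoeff_matrix, h₂.constantCoeff_matrix, one_mul]
  mul_x i := by
    rw [mul_assoc, h₂.mul_x, Finset.mul_sum]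
    simp only [mul_smul_comm, ← mul_assoc, h₁.mul_x, Finset.sum_mul, smul_mul_assoc,
      Finset.smul_sum, smul_smul, Matrix.mul_apply, Finset.sum_smul]
    rw [Finset.sum_comm]
    exact Finset.sum_congr rfl fun _ _ => Finset.sum_congr rfl fun _ _ => by rw [mul_comm]
  p_mul i := by
    rw [← mul_assoc, h₁.p_mul, Finset.sum_mul]
    simp only [smul_mul_assoc, mul_assoc, h₂.p_mul, Finset.mul_sum, mul_smul_comm,
      Finset.smul_sum, smul_smul, Matrix.mul_apply, Finset.sum_smul]
    rw [Finset.sum_comm]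
  hderiv_eq := by
    rw [hderiv_mul, h₁.hderiv_eq, h₂.hderiv_eq]
    simp only [derivative_matrix_mul_apply, Finset.sum_add_distrib, add_smul, Finset.sum_smul]
    congr 1
    · simp only [Finset.sum_mul, smul_mul_assoc]
      refine Finset.sum_congr rfl fun i _ => ?_
      rw [Finset.sum_comm]
      refine Finset.sum_congr rfl fun j _ => ?_
      rw [mul_assoc, mul_assoc, h₂.p_mul]
      simp only [Finset.mul_sum, mul_smul_comm, Finset.smul_sum, smul_smul, mul_assoc]
    · simp only [Finset.mul_sum, mul_smul_comm]
      rw [Finset.sum_comm, Finset.sum_comm (f := fun i j => ∑ l, _)]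
      refine Finset.sum_congr rfl fun j _ => ?_
      rw [Finset.sum_comm]
      refine Finset.sum_congr rfl fun i _ => ?_
      rw [← mul_assoc, ← mul_assoc, h₁.mul_x]
      simp only [Finset.sum_mul, smul_mul_assoc, Finset.smul_sum, smul_smul, mul_assoc, mul_comm]

/-- Needed for negative crossings. Inverting the linear relations gives those of u⁻¹, and the
differential equation follows by comparing (u⁻¹)' = -u⁻¹ u' u⁻¹ with the same formula for the
inverse matrix. Here `Q'` is the inverse of Q, not its derivative. -/
theorem inv {u : (PowerSeries B)ˣ} {Q Q' : Matrix ι ι (PowerSeries k)}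
    (h : IsGaussian x p (u : PowerSeries B) Q) (hQ : Q * Q' = 1) :
    IsGaussian x p (↑u⁻¹ : PowerSeries B) Q' := by
  have hQ' : Q' * Q = 1 := mul_eq_one_comm.1 hQ
  have hx (i : ι) : (↑u⁻¹ : PowerSeries B) * PowerSeries.C (x i) =
      ∑ j, Q' j i • (PowerSeries.C (x j) * (↑u⁻¹ : PowerSeries B)) := by
    have key : PowerSeries.C (x i) * u = ∑ j, Q' j i • (u * PowerSeries.C (x j)) := by
      simp only [h.mul_x, Finset.smul_sum, smul_smul]
      rw [Finset.sum_comm]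
      simp only [← Finset.sum_smul, mul_comm (Q' _ _), ← Matrix.mul_apply, hQ]
      simp [Matrix.one_apply]
    rw [← Units.mul_left_inj u, mul_assoc, key]
    simp [Finset.mul_sum, Finset.sum_mul, mul_assoc]
  have hp (i : ι) : PowerSeries.C (p i) * (↑u⁻¹ : PowerSeries B) =
      ∑ j, Q' i j • ((↑u⁻¹ : PowerSeries B) * PowerSeries.C (p j)) := by
    have key : u * PowerSeries.C (p i) = ∑ j, Q' i j • (PowerSeries.C (p j) * u) := by
      simp only [h.p_mul, Finset.smul_sum, smul_smul]
      rw [Finset.sum_comm]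
      simp only [← Finset.sum_smul, ← Matrix.mul_apply, hQ']
      simp [Matrix.one_apply]
    rw [← Units.mul_right_inj u, ← mul_assoc, key]
    simp [Finset.mul_sum, Finset.sum_mul, mul_assoc]
  refine ⟨?_, ?_, hx, hp, ?_⟩
  · have := congrArg PowerSeries.constantCoeff u.mul_inv
    rwa [map_mul, h.constantCoeff_eq, one_mul, map_one] at this
  · have := congrArg (fun M : Matrix ι ι (PowerSeries k) => M.map PowerSeries.constantCoeff) hQ
    rw [Matrix.map_mul, h.constantCoeff_matrix, one_mul] at this
    rwa [Matrix.map_one _ (map_zero _) (map_one _)] at this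
  · have h0 : hderiv (↑u⁻¹ : PowerSeries B) =
        -((↑u⁻¹ : PowerSeries B) * hderiv (u : PowerSeries B) * (↑u⁻¹ : PowerSeries B)) := by
      have := congrArg hderiv u.inv_mul
      rw [hderiv_mul, hderiv_one] at this
      rw [← neg_mul, ← Units.mul_left_inj u, mul_assoc _ _ (u : PowerSeries B), Units.inv_mul,
        mul_one, neg_eq_of_add_eq_zero_left this]
    have hQd (i j : ι) : PowerSeries.derivative k (Q' i j) =
        -∑ a, ∑ c, Q' i a * PowerSeries.derivative k (Q a c) * Q' c j := by
      have h1 (a b : ι) : ∑ l, PowerSeries.derivative k (Q a l) * Q' l b =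
          -∑ l, Q a l * PowerSeries.derivative k (Q' l b) := by
        rw [eq_neg_iff_add_eq_zero, ← Finset.sum_add_distrib, ← derivative_matrix_mul_apply, hQ,
          Matrix.one_apply]
        split_ifs <;> simp
      simp only [mul_assoc, ← Finset.mul_sum, h1, mul_neg, Finset.sum_neg_distrib, neg_neg]
      simp only [Finset.mul_sum, ← mul_assoc]
      rw [Finset.sum_comm]
      simp only [← Finset.sum_mul, ← Matrix.mul_apply, hQ']
      simp [Matrix.one_apply]
    rw [h0, h.hderiv_eq]
    simp only [hQd, neg_smul, Finset.sum_neg_distrib, neg_inj, Finset.sum_smul]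
    calc _ = ∑ a, ∑ c, PowerSeries.derivative k (Q a c) •
          (((↑u⁻¹ : PowerSeries B) * PowerSeries.C (x a)) * u *
            (PowerSeries.C (p c) * (↑u⁻¹ : PowerSeries B))) := by
          simp only [Finset.mul_sum, Finset.sum_mul, mul_smul_comm, smul_mul_assoc, mul_assoc]
      _ = ∑ a, ∑ c, ∑ i, ∑ j, (Q' i a * PowerSeries.derivative k (Q a c) * Q' c j) •
          (PowerSeries.C (x i) * (↑u⁻¹ : PowerSeries B) * PowerSeries.C (p j)) := by
          refine Finset.sum_congr rfl fun a _ => Finset.sum_congr rfl fun c _ => ?_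
          rw [hx, hp]
          simp only [Finset.mul_sum, Finset.sum_mul, mul_smul_comm, smul_mul_assoc, mul_assoc,
            Finset.smul_sum, smul_smul, Units.mul_inv_cancel_left]
          rw [Finset.sum_comm]
          refine Finset.sum_congr rfl fun _ _ => Finset.sum_congr rfl fun _ _ => ?_
          congr 1
          ring
      _ = _ := by
          rw [Finset.sum_congr rfl fun a _ => Finset.sum_comm, Finset.sum_comm]
          refine Finset.sum_congr rfl fun i _ => ?_
          rw [Finset.sum_congr rfl fun a _ => Finset.sum_comm, Finset.sum_comm]

theorem list_prod {α : Type*} (l : List α) (b : α → PowerSeries B)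
    (Q : α → Matrix ι ι (PowerSeries k)) (h : ∀ a ∈ l, IsGaussian x p (b a) (Q a)) :
    IsGaussian x p (l.map b).prod (l.map Q).prod := by
  induction l with
  | nil => exact one
  | cons a l ih =>
    rw [List.map_cons, List.map_cons, List.prod_cons, List.prod_cons]
    exact (h a (by simp)).mul (ih fun c hc => h c (by simp [hc]))

end IsGaussian

end GaussianElements

/-! ### Normal ordering -/

section NormalOrdering

variable {k : Type*} [Field k]

instance tensorPower_smulCommClass {I A : Type*} [Ring A] [Algebra k A] :
    SMulCommClass k (⨂[k] _ : I, A) (⨂[k] _ : I, A) := Algebra.to_smulCommClass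

instance tensorPower_isScalarTower {I A : Type*} [Ring A] [Algebra k A] :
    IsScalarTower k (⨂[k] _ : I, A) (⨂[k] _ : I, A) := IsScalarTower.right

theorem heisenberg_p_mul_x :
    (heisenbergGen .p * heisenbergGen .x : Heisenberg k) =
      heisenbergGen .x * heisenbergGen .p + 1 := by
  have := RingQuot.mkAlgHom_rel k (HeisenbergRel.comm (k := k))
  rw [map_sub, map_mul, map_mul, map_one] at this
  exact sub_eq_iff_eq_add'.1 this

theorem heisenberg_p_mul_x_pow (a : ℕ) :
    (heisenbergGen .p * heisenbergGen .x ^ a : Heisenberg k) =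
      heisenbergGen .x ^ a * heisenbergGen .p + a • heisenbergGen .x ^ (a - 1) := by
  induction a with
  | zero => simp
  | succ a ih =>
    rw [pow_succ, ← mul_assoc, ih, add_mul, mul_assoc, heisenberg_p_mul_x, mul_add, mul_one,
      ← mul_assoc, smul_mul_assoc, add_assoc, add_tsub_cancel_right, add_comm a 1, add_smul,
      one_smul]
    -- For a = 0 the truncated exponent a - 1 is harmless, since its term has coefficient zero.
    rcases a with _ | a
    · simp
    · rw [add_tsub_cancel_right, ← pow_succ, ← pow_succ]

theorem heisenberg_p_pow_mul_x (b : ℕ) :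
    (heisenbergGen .p ^ b * heisenbergGen .x : Heisenberg k) =
      heisenbergGen .x * heisenbergGen .p ^ b + b • heisenbergGen .p ^ (b - 1) := by
  induction b with
  | zero => simp
  | succ b ih =>
    rw [pow_succ', mul_assoc, ih, mul_add, ← mul_assoc, heisenberg_p_mul_x, add_mul, one_mul,
      mul_assoc, mul_smul_comm, add_assoc, add_tsub_cancel_right, add_comm b 1, add_smul,
      one_smul]
    rcases b with _ | b
    · simp
    · rw [add_tsub_cancel_right, ← pow_succ', ← pow_succ']

/-- A generator of the Weyl–Heisenberg algebra, placed on the leg `i`. -/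
def legGen {I : Type*} [DecidableEq I] (g : HeisenbergGen) (i : I) : ⨂[k] _ : I, Heisenberg k :=
  PiTensorProduct.singleAlgHom (R := k) (A := fun _ : I => Heisenberg k) i (heisenbergGen g)

section

variable {A : Type*} [Ring A] [Algebra k A] {I : Type*} [DecidableEq I]

theorem singleAlgHom_mul_tprod (i : I) (y : A) (a : I → A) :
    PiTensorProduct.singleAlgHom (R := k) (A := fun _ : I => A) i y * PiTensorProduct.tprod k a =
      PiTensorProduct.tprod k (Function.update a i (y * a i)) := by
  rw [PiTensorProduct.singleAlgHom_apply, PiTensorProduct.tprod_mul_tprod]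
  congr 1
  ext j
  by_cases h : j = i
  · subst h; simp
  · simp [h]

theorem tprod_mul_singleAlgHom (i : I) (y : A) (a : I → A) :
    PiTensorProduct.tprod k a * PiTensorProduct.singleAlgHom (R := k) (A := fun _ : I => A) i y =
      PiTensorProduct.tprod k (Function.update a i (a i * y)) := by
  rw [PiTensorProduct.singleAlgHom_apply, PiTensorProduct.tprod_mul_tprod]
  congr 1
  ext j
  by_cases h : j = i
  · subst h; simp
  · simp [h]

theorem commute_singleAlgHom {i j : I} (h : i ≠ j) (y z : A) :
    Commute (PiTensorProduct.singleAlgHom (R := k) (A := fun _ : I => A) i y)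
      (PiTensorProduct.singleAlgHom (R := k) (A := fun _ : I => A) j z) := by
  rw [PiTensorProduct.singleAlgHom_apply, PiTensorProduct.singleAlgHom_apply]
  exact (Pi.mulSingle_commute (f := fun _ : I => A) h y z).tprod

end

theorem legGen_p_mul_x {I : Type*} [DecidableEq I] (i j : I) :
    (legGen .p i * legGen .x j : ⨂[k] _ : I, Heisenberg k) =
      legGen .x j * legGen .p i + if i = j then 1 else 0 := by
  by_cases h : i = j
  · subst h
    rw [if_pos rfl, legGen, legGen, ← map_mul, ← map_mul, heisenberg_p_mul_x, map_add, map_one]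
  · rw [if_neg h, add_zero]
    exact commute_singleAlgHom h _ _

/-- The normally ordered monomial with exponents `m`. -/
def normalMonomial {n : ℕ} (m : Fin n ⊕ Fin n →₀ ℕ) (i : Fin n) : Heisenberg k :=
  heisenbergGen .x ^ m (Sum.inl i) * heisenbergGen .p ^ m (Sum.inr i)

variable {n : ℕ}

theorem normalOrder_monomial (m : Fin n ⊕ Fin n →₀ ℕ) :
    normalOrder n (MvPolynomial.monomial m (1 : k)) =
      PiTensorProduct.tprod k (normalMonomial m) := by
  have h : MvPolynomial.monomial m (1 : k) = MvPolynomial.basisMonomials _ k m := by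
    rw [MvPolynomial.coe_basisMonomials]
  rw [normalOrder, h, Module.Basis.constr_basis]
  rfl

theorem normalOrder_one : normalOrder n (1 : MvPolynomial (Fin n ⊕ Fin n) k) = 1 := by
  have : normalMonomial (k := k) (0 : Fin n ⊕ Fin n →₀ ℕ) = 1 := by
    ext i; simp [normalMonomial]
  rw [← MvPolynomial.C_1, MvPolynomial.C_apply, normalOrder_monomial, this]
  rfl

theorem linearMap_ext_monomial {V : Type*} [AddCommMonoid V] [Module k V] {σ : Type*}
    {f g : MvPolynomial σ k →ₗ[k] V}
    (h : ∀ m, f (MvPolynomial.monomial m 1) = g (MvPolynomial.monomial m 1)) : f = g :=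
  (MvPolynomial.basisMonomials σ k).ext fun m => by
    rw [MvPolynomial.coe_basisMonomials]; exact h m

theorem normalOrder_X_inl_mul (i : Fin n) (f : MvPolynomial (Fin n ⊕ Fin n) k) :
    normalOrder n (MvPolynomial.X (Sum.inl i) * f) = legGen .x i * normalOrder n f := by
  suffices h : normalOrder n ∘ₗ LinearMap.mulLeft k (MvPolynomial.X (Sum.inl i)) =
      LinearMap.mulLeft k (legGen .x i) ∘ₗ normalOrder (k := k) n from LinearMap.congr_fun h f
  refine linearMap_ext_monomial fun m => ?_
  simp only [LinearMap.comp_apply, LinearMap.mulLeft_apply, MvPolynomial.X,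
    MvPolynomial.monomial_mul, one_mul, normalOrder_monomial, legGen, singleAlgHom_mul_tprod]
  congr 1
  ext j
  by_cases h : j = i
  · subst h; simp [normalMonomial, pow_add, mul_assoc]
  · simp [normalMonomial, h]

theorem normalOrder_X_inr_mul (i : Fin n) (f : MvPolynomial (Fin n ⊕ Fin n) k) :
    normalOrder n (MvPolynomial.X (Sum.inr i) * f) = normalOrder n f * legGen .p i := by
  suffices h : normalOrder n ∘ₗ LinearMap.mulLeft k (MvPolynomial.X (Sum.inr i)) =
      LinearMap.mulRight k (legGen .p i) ∘ₗ normalOrder (k := k) n from LinearMap.congr_fun h f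
  refine linearMap_ext_monomial fun m => ?_
  simp only [LinearMap.comp_apply, LinearMap.mulLeft_apply, LinearMap.mulRight_apply,
    MvPolynomial.X, MvPolynomial.monomial_mul, one_mul, normalOrder_monomial, legGen,
    tprod_mul_singleAlgHom]
  congr 1
  ext j
  by_cases h : j = i
  · subst h; simp [normalMonomial, add_comm 1, pow_succ, mul_assoc]
  · simp [normalMonomial, h]

/-- The only factor that x_i does not commute with is the power of p_i on its own leg, and [p^b, x]
= b p^(b-1) is the action of ∂/∂p. The next lemma is the mirror image, with [p, x^a] acting as ∂/∂x.
-/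
theorem normalOrder_mul_x (i : Fin n) (f : MvPolynomial (Fin n ⊕ Fin n) k) :
    normalOrder n f * legGen .x i =
      legGen .x i * normalOrder n f + normalOrder n (MvPolynomial.pderiv (Sum.inr i) f) := by
  suffices h : LinearMap.mulRight k (legGen .x i) ∘ₗ normalOrder (k := k) n =
      LinearMap.mulLeft k (legGen .x i) ∘ₗ normalOrder (k := k) n + normalOrder n ∘ₗ
        (MvPolynomial.pderiv (Sum.inr i)).toLinearMap from LinearMap.congr_fun h f
  refine linearMap_ext_monomial fun m => ?_
  have h1 : normalMonomial (k := k) m i * heisenbergGen .x =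
      heisenbergGen .x * normalMonomial m i +
        (m (Sum.inr i) : k) • normalMonomial (m - Finsupp.single (Sum.inr i) 1) i := by
    rw [normalMonomial, normalMonomial, mul_assoc, heisenberg_p_pow_mul_x, mul_add, ← mul_assoc,
      ← pow_succ, pow_succ', mul_assoc, mul_smul_comm, Nat.cast_smul_eq_nsmul]
    simp
  have h2 : MvPolynomial.monomial (m - Finsupp.single (Sum.inr i) 1) (m (Sum.inr i) : k) =
      (m (Sum.inr i) : k) • MvPolynomial.monomial (m - Finsupp.single (Sum.inr i) 1) 1 := by
    rw [MvPolynomial.smul_monomial, smul_eq_mul, mul_one]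
  have h3 : Function.update (normalMonomial (k := k) m) i
      (normalMonomial (m - Finsupp.single (Sum.inr i) 1) i) =
      normalMonomial (m - Finsupp.single (Sum.inr i) 1) := by
    ext j
    by_cases h : j = i
    · subst h; simp
    · simp [normalMonomial, h]
  simp only [LinearMap.comp_apply, LinearMap.add_apply, LinearMap.mulLeft_apply,
    LinearMap.mulRight_apply, Derivation.coeFn_coe, MvPolynomial.pderiv_monomial, one_mul, h2,
    map_smul, normalOrder_monomial, legGen, singleAlgHom_mul_tprod, tprod_mul_singleAlgHom, h1]
  rw [MultilinearMap.map_update_add, MultilinearMap.map_update_smul, h3]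

theorem p_mul_normalOrder (i : Fin n) (f : MvPolynomial (Fin n ⊕ Fin n) k) :
    legGen .p i * normalOrder n f =
      normalOrder n f * legGen .p i + normalOrder n (MvPolynomial.pderiv (Sum.inl i) f) := by
  suffices h : LinearMap.mulLeft k (legGen .p i) ∘ₗ normalOrder (k := k) n =
      LinearMap.mulRight k (legGen .p i) ∘ₗ normalOrder (k := k) n + normalOrder n ∘ₗ
        (MvPolynomial.pderiv (Sum.inl i)).toLinearMap from LinearMap.congr_fun h f
  refine linearMap_ext_monomial fun m => ?_
  have h1 : heisenbergGen .p * normalMonomial (k := k) m i =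
      normalMonomial m i * heisenbergGen .p +
        (m (Sum.inl i) : k) • normalMonomial (m - Finsupp.single (Sum.inl i) 1) i := by
    simp [normalMonomial, ← mul_assoc, heisenberg_p_mul_x_pow, add_mul, Nat.cast_smul_eq_nsmul]
    simp [mul_assoc, ← pow_succ, ← pow_succ']
  have h2 : MvPolynomial.monomial (m - Finsupp.single (Sum.inl i) 1) (m (Sum.inl i) : k) =
      (m (Sum.inl i) : k) • MvPolynomial.monomial (m - Finsupp.single (Sum.inl i) 1) 1 := by
    rw [MvPolynomial.smul_monomial, smul_eq_mul, mul_one]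
  have h3 : Function.update (normalMonomial (k := k) m) i
      (normalMonomial (m - Finsupp.single (Sum.inl i) 1) i) =
      normalMonomial (m - Finsupp.single (Sum.inl i) 1) := by
    ext j
    by_cases h : j = i
    · subst h; simp
    · simp [normalMonomial, h]
  simp only [LinearMap.comp_apply, LinearMap.add_apply, LinearMap.mulLeft_apply,
    LinearMap.mulRight_apply, Derivation.coeFn_coe, MvPolynomial.pderiv_monomial, one_mul, h2,
    map_smul, normalOrder_monomial, legGen, singleAlgHom_mul_tprod, tprod_mul_singleAlgHom, h1]
  rw [MultilinearMap.map_update_add, MultilinearMap.map_update_smul, h3]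

end NormalOrdering

/-! ### The exponential series -/

section HExp

variable {k : Type*} [Field k] {B : Type*} [CommRing B] [Algebra k B]

/-- Every truncation beyond d gives the same coefficient of h^d. One truncation can thus serve all
coefficients up to a bound, which reduces statements about the exponential to polynomials in f. -/
theorem coeff_hexp {f : PowerSeries B} (hf : PowerSeries.constantCoeff f = 0) {d M : ℕ}
    (h : d < M) :
    PowerSeries.coeff d (hexp (k := k) f) =
      PowerSeries.coeff d (∑ m ∈ Finset.range M, ((m ! : k)⁻¹) • f ^ m) := by
  simp only [hexp, PowerSeries.coeff_mk, map_sum, PowerSeries.coeff_smul]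
  refine Finset.sum_subset (Finset.range_mono h) fun m _ hm => ?_
  rw [Finset.mem_range, not_lt] at hm
  have h1 : (X : PowerSeries B) ^ m ∣ f ^ m := pow_dvd_pow_of_dvd (PowerSeries.X_dvd_iff.2 hf) m
  rw [PowerSeries.X_pow_dvd_iff.1 h1 d hm, smul_zero]

theorem hexp_zero : hexp (k := k) (0 : PowerSeries B) = 1 := by
  ext d
  rw [coeff_hexp (by simp) (Nat.lt_succ_self d), Finset.sum_range_succ', Finset.sum_eq_zero]
  · simp
  · simp

theorem derivation_hexp [CharZero k] {f : PowerSeries B} (hf : PowerSeries.constantCoeff f = 0)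
    (δ : PowerSeries B →ₗ[k] PowerSeries B) (hδ : ∀ y z, δ (y * z) = δ y * z + y * δ z)
    (hc : ∀ d y z, (∀ e ≤ d + 1, PowerSeries.coeff e y = PowerSeries.coeff e z) →
      PowerSeries.coeff d (δ y) = PowerSeries.coeff d (δ z)) :
    δ (hexp (k := k) f) = δ f * hexp (k := k) f := by
  have h1 : δ 1 = 0 := by simpa using hδ 1 1
  have hpow (m : ℕ) : δ (f ^ (m + 1)) = ((m + 1 : ℕ) : k) • (δ f * f ^ m) := by
    induction m with
    | zero => simp
    | succ m ih =>
      rw [pow_succ, hδ, ih, Nat.cast_succ (m + 1), add_smul, one_smul, pow_succ, smul_mul_assoc]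
      ring_nf
  have hsum (M : ℕ) : δ (∑ m ∈ Finset.range (M + 1), ((m ! : k)⁻¹) • f ^ m) =
      δ f * ∑ m ∈ Finset.range M, ((m ! : k)⁻¹) • f ^ m := by
    rw [Finset.sum_range_succ', map_add, map_sum, Finset.mul_sum]
    simp only [map_smul, pow_zero, h1, smul_zero, add_zero, hpow, smul_smul, mul_smul_comm]
    refine Finset.sum_congr rfl fun m _ => ?_
    congr 1
    have : ((m + 1 : ℕ) : k) ≠ 0 := Nat.cast_ne_zero.2 m.succ_ne_zero
    have : (m ! : k) ≠ 0 := Nat.cast_ne_zero.2 m.factorial_ne_zero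
    rw [Nat.factorial_succ, Nat.cast_mul]
    field_simp
  ext d
  rw [hc d _ (∑ m ∈ Finset.range (d + 2 + 1), ((m ! : k)⁻¹) • f ^ m)
    (fun e he => coeff_hexp hf (by omega)), hsum, PowerSeries.coeff_mul, PowerSeries.coeff_mul]
  refine Finset.sum_congr rfl fun q hq => ?_
  have := Finset.HasAntidiagonal.mem_antidiagonal.1 hq
  rw [coeff_hexp hf (show q.2 < d + 2 by omega)]

theorem hderiv_hexp [CharZero k] {f : PowerSeries B} (hf : PowerSeries.constantCoeff f = 0) :
    hderiv (hexp (k := k) f) = hderiv f * hexp (k := k) f :=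
  derivation_hexp hf
    { toFun := hderiv
      map_add' := fun y z => by ext n; simp only [map_add, coeff_hderiv, smul_add]
      map_smul' := fun c z => by ext n; simp [coeff_hderiv] }
    hderiv_mul fun d y z h => by
      change PowerSeries.coeff d (hderiv y) = PowerSeries.coeff d (hderiv z)
      rw [coeff_hderiv, coeff_hderiv, h _ le_rfl]

theorem deform_derivation_hexp [CharZero k] {f : PowerSeries B}
    (hf : PowerSeries.constantCoeff f = 0) (δ : Derivation k B B) :
    deform δ.toLinearMap (hexp (k := k) f) = deform δ.toLinearMap f * hexp (k := k) f :=
  derivation_hexp hf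
    { toFun := deform δ.toLinearMap
      map_add' := deform_add _
      map_smul' := fun c z => by ext n; simp [coeff_deform] }
    (fun y z => by
      change deform _ _ = deform _ _ * _ + _ * deform _ _
      ext n
      simp only [coeff_deform, PowerSeries.coeff_mul, map_add, map_sum, Derivation.coeFn_coe,
        Derivation.leibniz, smul_eq_mul, ← Finset.sum_add_distrib]
      exact Finset.sum_congr rfl fun _ _ => by ring)
    fun d y z h => by
      change PowerSeries.coeff d (deform _ _) = PowerSeries.coeff d (deform _ _)
      rw [coeff_deform, coeff_deform, h d (by omega)]

end HExp

/-! ### The normally ordered exponentials are Gaussian -/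

section GaussianIsGaussian

variable {k : Type*} [Field k] {n : ℕ}

theorem quadraticForm_eq (M : Matrix (Fin n) (Fin n) (PowerSeries k)) :
    quadraticForm M = ∑ i, ∑ j, M i j •
      (PowerSeries.C (MvPolynomial.X (Sum.inl i)) *
        PowerSeries.C (MvPolynomial.X (Sum.inr j) : MvPolynomial (Fin n ⊕ Fin n) k)) := by
  simp only [quadraticForm, map_mul]
  rfl

theorem constantCoeff_quadraticForm {M : Matrix (Fin n) (Fin n) (PowerSeries k)}
    (hM : M.map PowerSeries.constantCoeff = 0) :
    PowerSeries.constantCoeff (quadraticForm M) = 0 := by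
  simp only [quadraticForm, map_sum, map_mul]
  refine Finset.sum_eq_zero fun i _ => Finset.sum_eq_zero fun j _ => ?_
  have h : PowerSeries.constantCoeff (M i j) = 0 := congrFun (congrFun hM i) j
  rw [← PowerSeries.coeff_zero_eq_constantCoeff_apply, PowerSeries.coeff_map,
    PowerSeries.coeff_zero_eq_constantCoeff_apply, h, map_zero, zero_mul]

theorem pderiv_inl_quadraticForm (M : Matrix (Fin n) (Fin n) (PowerSeries k)) (i : Fin n) :
    deform (MvPolynomial.pderiv (R := k) (Sum.inl i)).toLinearMap (quadraticForm M) =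
      ∑ j, M i j •
        PowerSeries.C (MvPolynomial.X (Sum.inr j) : MvPolynomial (Fin n ⊕ Fin n) k) := by
  rw [quadraticForm_eq, deform_sum, Finset.sum_eq_single i]
  · rw [deform_sum]
    refine Finset.sum_congr rfl fun j _ => ?_
    rw [← map_mul, deform_smul, deform_C]
    simp
  · intro b _ hb
    rw [deform_sum]
    refine Finset.sum_eq_zero fun j _ => ?_
    rw [← map_mul, deform_smul, deform_C]
    simp [MvPolynomial.pderiv_X, hb]
  · simp

theorem pderiv_inr_quadraticForm (M : Matrix (Fin n) (Fin n) (PowerSeries k)) (i : Fin n) :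
    deform (MvPolynomial.pderiv (R := k) (Sum.inr i)).toLinearMap (quadraticForm M) =
      ∑ j, M j i •
        PowerSeries.C (MvPolynomial.X (Sum.inl j) : MvPolynomial (Fin n ⊕ Fin n) k) := by
  rw [quadraticForm_eq, deform_sum]
  refine Finset.sum_congr rfl fun j _ => ?_
  rw [deform_sum, Finset.sum_eq_single i]
  · rw [← map_mul, deform_smul, deform_C]
    simp
  · intro b _ hb
    rw [← map_mul, deform_smul, deform_C]
    simp [MvPolynomial.pderiv_X, hb]
  · simp

theorem hderiv_quadraticForm (M : Matrix (Fin n) (Fin n) (PowerSeries k)) :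
    hderiv (quadraticForm M) = ∑ i, ∑ j, PowerSeries.derivative k (M i j) •
      (PowerSeries.C (MvPolynomial.X (Sum.inl i)) *
        PowerSeries.C (MvPolynomial.X (Sum.inr j) : MvPolynomial (Fin n ⊕ Fin n) k)) := by
  have hsum {ι : Type} (s : Finset ι)
      (z : ι → PowerSeries (MvPolynomial (Fin n ⊕ Fin n) k)) :
      hderiv (∑ i ∈ s, z i) = ∑ i ∈ s, hderiv (z i) := by
    ext : 1
    simp only [coeff_hderiv, map_sum, Finset.smul_sum]
  simp only [quadraticForm_eq, hsum, hderiv_smul, ← map_mul, hderiv_C, smul_zero, add_zero]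

/-- The exponent contains Q - 1; the term in which a generator passes unchanged supplies the missing
1. -/
theorem add_sum_sub_one_smul {B : Type*} [Ring B] [Algebra k B] {ι : Type*} [Fintype ι]
    [DecidableEq ι] (Q : Matrix ι ι (PowerSeries k)) (z : ι → PowerSeries B) (i : ι) :
    z i + ∑ j, (Q - 1) i j • z j = ∑ j, Q i j • z j := by
  simp [Matrix.sub_apply, sub_smul, Matrix.one_apply]

/-- The properties of normal ordering that are used for exponentials of quadratic forms. -/
structure IsNormalOrdering {B : Type*} [Ring B] [Algebra k B]
    (N : MvPolynomial (Fin n ⊕ Fin n) k →ₗ[k] B) (x p : Fin n → B) : Prop where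
  map_one : N 1 = 1
  x_mul : ∀ i f, N (MvPolynomial.X (Sum.inl i) * f) = x i * N f
  p_mul : ∀ i f, N (MvPolynomial.X (Sum.inr i) * f) = N f * p i
  mul_x : ∀ i f, N f * x i = x i * N f + N (MvPolynomial.pderiv (Sum.inr i) f)
  p_mul_map : ∀ i f, p i * N f = N f * p i + N (MvPolynomial.pderiv (Sum.inl i) f)

theorem isNormalOrdering_normalOrder :
    IsNormalOrdering (normalOrder (k := k) n) (legGen .x) (legGen .p) where
  map_one := normalOrder_one
  x_mul := normalOrder_X_inl_mul
  p_mul := normalOrder_X_inr_mul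
  mul_x := normalOrder_mul_x
  p_mul_map := p_mul_normalOrder

/-- Commuting with x_i or p_i differentiates the symbol by p_i or x_i, and differentiating the
exponential multiplies it by a linear form with coefficients from Q - 1. In the same way d/dh
multiplies it by ∑ Q'_ij x_i p_j, and normal ordering puts these x's on the left and these p's on
the right. -/
theorem IsNormalOrdering.isGaussian [CharZero k] {B : Type*} [Ring B] [Algebra k B]
    {N : MvPolynomial (Fin n ⊕ Fin n) k →ₗ[k] B} {x p : Fin n → B} (hN : IsNormalOrdering N x p)
    {Q : Matrix (Fin n) (Fin n) (PowerSeries k)} (hQ : Q.map PowerSeries.constantCoeff = 1) :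
    IsGaussian x p (deform N (hexp (k := k) (quadraticForm (Q - 1)))) Q := by
  have hQ1 : (Q - 1).map PowerSeries.constantCoeff = 0 := by
    have h1 : (1 : Matrix (Fin n) (Fin n) (PowerSeries k)).map PowerSeries.constantCoeff = 1 :=
      Matrix.map_one _ (map_zero _) (_root_.map_one _)
    rw [Matrix.map_sub _ (map_sub _), hQ, h1, sub_self]
  have hq := constantCoeff_quadraticForm hQ1
  have hxl (i : Fin n) (f : PowerSeries (MvPolynomial (Fin n ⊕ Fin n) k)) :
      deform N (PowerSeries.C (MvPolynomial.X (Sum.inl i)) * f) =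
        PowerSeries.C (x i) * deform N f := by
    ext d
    rw [coeff_deform, PowerSeries.coeff_C_mul, PowerSeries.coeff_C_mul, coeff_deform, hN.x_mul]
  have hpr (i : Fin n) (f : PowerSeries (MvPolynomial (Fin n ⊕ Fin n) k)) :
      deform N (PowerSeries.C (MvPolynomial.X (Sum.inr i)) * f) =
        deform N f * PowerSeries.C (p i) := by
    ext d
    rw [coeff_deform, PowerSeries.coeff_C_mul, PowerSeries.coeff_mul_C, coeff_deform, hN.p_mul]
  set E := hexp (k := k) (quadraticForm (Q - 1)) with hE
  refine ⟨?_, hQ, fun i => ?_, fun i => ?_, ?_⟩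
  · rw [← PowerSeries.coeff_zero_eq_constantCoeff_apply, coeff_deform, hE,
      coeff_hexp hq Nat.zero_lt_one]
    simp [hN.map_one]
  · have h1 : deform N E * PowerSeries.C (x i) = PowerSeries.C (x i) * deform N E +
        deform N (deform (MvPolynomial.pderiv (R := k) (Sum.inr i)).toLinearMap E) := by
      ext d
      rw [PowerSeries.coeff_mul_C, map_add, PowerSeries.coeff_C_mul, coeff_deform, coeff_deform,
        coeff_deform, hN.mul_x]
      rfl
    rw [h1, hE, deform_derivation_hexp hq, ← hE, pderiv_inr_quadraticForm, Finset.sum_mul, deform_sum]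
    simp only [smul_mul_assoc, deform_smul, hxl]
    have h2 := add_sum_sub_one_smul Q.transpose (fun j => PowerSeries.C (x j) * deform N E) i
    rwa [← Matrix.transpose_one, ← Matrix.transpose_sub] at h2
  · have h1 : PowerSeries.C (p i) * deform N E = deform N E * PowerSeries.C (p i) +
        deform N (deform (MvPolynomial.pderiv (R := k) (Sum.inl i)).toLinearMap E) := by
      ext d
      rw [PowerSeries.coeff_C_mul, map_add, PowerSeries.coeff_mul_C, coeff_deform, coeff_deform,
        coeff_deform, hN.p_mul_map]
      rfl
    rw [h1, hE, deform_derivation_hexp hq, ← hE, pderiv_inl_quadraticForm, Finset.sum_mul, deform_sum]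
    simp only [smul_mul_assoc, deform_smul, hpr]
    exact add_sum_sub_one_smul Q (fun j => deform N E * PowerSeries.C (p j)) i
  · rw [← deform_hderiv, hderiv_hexp hq, hderiv_quadraticForm, Finset.sum_mul, deform_sum]
    refine Finset.sum_congr rfl fun i _ => ?_
    rw [Finset.sum_mul, deform_sum]
    refine Finset.sum_congr rfl fun j _ => ?_
    have h0 : PowerSeries.derivative k ((1 : Matrix (Fin n) (Fin n) (PowerSeries k)) i j) = 0 := by
      rw [Matrix.one_apply]
      split_ifs <;> simp
    rw [smul_mul_assoc, deform_smul, mul_assoc, hxl, hpr, Matrix.sub_apply, map_sub, h0, sub_zero,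
      mul_assoc]

theorem isGaussian_gaussian [CharZero k] {Q : Matrix (Fin n) (Fin n) (PowerSeries k)}
    (hQ : Q.map PowerSeries.constantCoeff = 1) :
    IsGaussian (legGen (k := k) .x) (legGen .p) (gaussian Q) Q :=
  isNormalOrdering_normalOrder.isGaussian hQ

theorem gaussian_one : gaussian (1 : Matrix (Fin n) (Fin n) (PowerSeries k)) = 1 := by
  have h : quadraticForm (0 : Matrix (Fin n) (Fin n) (PowerSeries k)) = 0 := by
    simp [quadraticForm]
  rw [gaussian, sub_self, h, hexp_zero]
  ext d
  rw [deform, PowerSeries.coeff_mk, PowerSeries.coeff_one, PowerSeries.coeff_one]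
  split_ifs
  · exact normalOrder_one
  · exact map_zero _

end GaussianIsGaussian

/-! ### The vacuum functional and the center of the Weyl–Heisenberg algebra -/

section Vacuum

variable {k : Type*} [Field k]

/-- The action of the Weyl–Heisenberg algebra on polynomials, in which `x` acts by multiplication
and `p` acts by differentiation. -/
def fockAction : Heisenberg k →ₐ[k] Module.End k (Polynomial k) :=
  RingQuot.liftAlgHom k ⟨FreeAlgebra.lift k fun
    | .x => LinearMap.mulLeft k Polynomial.X
    | .p => Polynomial.derivative, by
      rintro _ _ ⟨⟩
      refine LinearMap.ext fun f => ?_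
      simp [Polynomial.derivative_mul]⟩

theorem fockAction_x (f : Polynomial k) :
    fockAction (heisenbergGen .x) f = Polynomial.X * f := by
  simp [fockAction, heisenbergGen, RingQuot.liftAlgHom_mkAlgHom_apply]

theorem fockAction_p (f : Polynomial k) :
    fockAction (heisenbergGen .p) f = Polynomial.derivative f := by
  simp [fockAction, heisenbergGen, RingQuot.liftAlgHom_mkAlgHom_apply]

/-- The vacuum expectation value. -/
def vacuum : Heisenberg k →ₗ[k] k :=
  Polynomial.lcoeff k 0 ∘ₗ LinearMap.applyₗ (1 : Polynomial k) ∘ₗ fockAction.toLinearMap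

theorem vacuum_apply (z : Heisenberg k) : vacuum z = (fockAction z 1).coeff 0 := rfl

theorem vacuum_one : vacuum (1 : Heisenberg k) = 1 := by
  simp [vacuum_apply]

theorem vacuum_x_mul (z : Heisenberg k) : vacuum (heisenbergGen .x * z) = 0 := by
  simp [vacuum_apply, fockAction_x]

theorem vacuum_mul_p (z : Heisenberg k) : vacuum (z * heisenbergGen .p) = 0 := by
  simp [vacuum_apply, fockAction_p]

/-- The normal ordering map in one pair of variables. -/
def normalOrderOne : MvPolynomial (Fin 1 ⊕ Fin 1) k →ₗ[k] Heisenberg k :=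
  contractLegs 1 ∘ₗ normalOrder 1

theorem contractLegs_tprod {A : Type*} [Ring A] [Algebra k A] (n : ℕ) (a : Fin n → A) :
    contractLegs (k := k) n (PiTensorProduct.tprod k a) =
      (List.ofFn fun i => a (Fin.rev i)).prod := by
  simp [contractLegs, MultilinearMap.mkPiAlgebraFin_apply]

theorem contractLegs_one_mul {A : Type*} [Ring A] [Algebra k A] (y z : ⨂[k] _ : Fin 1, A) :
    contractLegs (k := k) 1 (y * z) = contractLegs 1 y * contractLegs 1 z := by
  induction y using PiTensorProduct.induction_on with
  | smul_tprod r a =>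
    induction z using PiTensorProduct.induction_on with
    | smul_tprod s b =>
      simp [contractLegs_tprod, PiTensorProduct.tprod_mul_tprod]
    | add z w hz hw => rw [mul_add, map_add, hz, hw, map_add, mul_add]
  | add y w hy hw => rw [add_mul, map_add, hy, hw, map_add, add_mul]

theorem contractLegs_one_legGen (g : HeisenbergGen) (i : Fin 1) :
    contractLegs (k := k) 1 (legGen g i) = heisenbergGen g := by
  rw [Subsingleton.elim i 0, legGen, PiTensorProduct.singleAlgHom_apply, contractLegs_tprod]
  simp

theorem normalOrderOne_one : normalOrderOne (1 : MvPolynomial (Fin 1 ⊕ Fin 1) k) = 1 := by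
  rw [normalOrderOne, LinearMap.comp_apply, normalOrder_one, PiTensorProduct.one_def,
    contractLegs_tprod]
  simp

theorem normalOrderOne_x_mul (f : MvPolynomial (Fin 1 ⊕ Fin 1) k) :
    normalOrderOne (MvPolynomial.X (Sum.inl 0) * f) = heisenbergGen .x * normalOrderOne f := by
  rw [normalOrderOne, LinearMap.comp_apply, normalOrder_X_inl_mul, contractLegs_one_mul,
    contractLegs_one_legGen]
  rfl

theorem normalOrderOne_p_mul (f : MvPolynomial (Fin 1 ⊕ Fin 1) k) :
    normalOrderOne (MvPolynomial.X (Sum.inr 0) * f) = normalOrderOne f * heisenbergGen .p := by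
  rw [normalOrderOne, LinearMap.comp_apply, normalOrder_X_inr_mul, contractLegs_one_mul,
    contractLegs_one_legGen]
  rfl

theorem normalOrderOne_mul_x (f : MvPolynomial (Fin 1 ⊕ Fin 1) k) :
    normalOrderOne f * heisenbergGen .x = heisenbergGen .x * normalOrderOne f +
      normalOrderOne (MvPolynomial.pderiv (Sum.inr 0) f) := by
  have := congrArg (contractLegs (k := k) 1) (normalOrder_mul_x 0 f)
  rwa [map_add, contractLegs_one_mul, contractLegs_one_mul, contractLegs_one_legGen] at this

theorem p_mul_normalOrderOne (f : MvPolynomial (Fin 1 ⊕ Fin 1) k) :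
    heisenbergGen .p * normalOrderOne f = normalOrderOne f * heisenbergGen .p +
      normalOrderOne (MvPolynomial.pderiv (Sum.inl 0) f) := by
  have := congrArg (contractLegs (k := k) 1) (p_mul_normalOrder 0 f)
  rwa [map_add, contractLegs_one_mul, contractLegs_one_mul, contractLegs_one_legGen] at this

/-- Every nonconstant normally ordered monomial starts with x or ends with p, and both are killed.
-/
theorem vacuum_normalOrderOne (f : MvPolynomial (Fin 1 ⊕ Fin 1) k) :
    vacuum (normalOrderOne f) = MvPolynomial.constantCoeff f := by
  induction f using MvPolynomial.induction_on with
  | C a =>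
    rw [← mul_one (MvPolynomial.C a), ← MvPolynomial.smul_eq_C_mul, map_smul, normalOrderOne_one,
      map_smul, vacuum_one]
    simp
  | add f g ih ih' => rw [map_add, map_add, map_add, ih, ih']
  | mul_X f i ih =>
    rw [mul_comm]
    rcases i with i | i <;> rw [Subsingleton.elim i 0]
    · rw [normalOrderOne_x_mul, vacuum_x_mul]; simp
    · rw [normalOrderOne_p_mul, vacuum_mul_p]; simp

/-- The image contains 1 and is stable under left multiplication by x and by p, the latter because p
can be moved to the right at the cost of a derivative of the symbol. -/
theorem normalOrderOne_surjective :
    Function.Surjective (normalOrderOne : MvPolynomial (Fin 1 ⊕ Fin 1) k →ₗ[k] Heisenberg k) := by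
  have key (a : FreeAlgebra k HeisenbergGen) (f : MvPolynomial (Fin 1 ⊕ Fin 1) k) :
      ∃ g, normalOrderOne g = RingQuot.mkAlgHom k (HeisenbergRel k) a * normalOrderOne f := by
    induction a using FreeAlgebra.induction generalizing f with
    | grade0 r => exact ⟨r • f, by rw [map_smul, AlgHom.commutes, Algebra.smul_def]⟩
    | grade1 g =>
      cases g with
      | x => exact ⟨_, normalOrderOne_x_mul f⟩
      | p => exact ⟨_, (by rw [map_add, normalOrderOne_p_mul]; exact
          (p_mul_normalOrderOne f).symm : normalOrderOne (MvPolynomial.X (Sum.inr 0) * f +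
            MvPolynomial.pderiv (Sum.inl 0) f) = _)⟩
    | mul a b ha hb =>
      obtain ⟨g, hg⟩ := hb f
      obtain ⟨g', hg'⟩ := ha g
      exact ⟨g', by rw [hg', hg, map_mul, mul_assoc]⟩
    | add a b ha hb =>
      obtain ⟨g, hg⟩ := ha f
      obtain ⟨g', hg'⟩ := hb f
      exact ⟨g + g', by rw [map_add, hg, hg', map_add, add_mul]⟩
  intro z
  obtain ⟨a, rfl⟩ := RingQuot.mkAlgHom_surjective k (HeisenbergRel k) z
  obtain ⟨g, hg⟩ := key a 1
  exact ⟨g, by rw [hg, normalOrderOne_one, mul_one]⟩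

theorem normalOrderOne_pderiv_eq_zero {f : MvPolynomial (Fin 1 ⊕ Fin 1) k}
    (h : ∀ g, Commute (heisenbergGen g) (normalOrderOne f)) (i : Fin 1 ⊕ Fin 1) :
    normalOrderOne (MvPolynomial.pderiv i f) = 0 := by
  rcases i with i | i <;> rw [Subsingleton.elim i 0]
  · have := p_mul_normalOrderOne f
    rwa [(h .p).eq, left_eq_add] at this
  · have := normalOrderOne_mul_x f
    rwa [(h .x).eq, left_eq_add] at this

/-- The kernel of normal ordering is stable under partial derivatives. Differentiating turns any
coefficient into a constant coefficient times a nonzero integer, and the vacuum functional detects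
constant coefficients. -/
theorem coeff_eq_zero_of_normalOrderOne_eq_zero [CharZero k]
    (m : Fin 1 ⊕ Fin 1 →₀ ℕ) {f : MvPolynomial (Fin 1 ⊕ Fin 1) k} (h : normalOrderOne f = 0) :
    MvPolynomial.coeff m f = 0 := by
  induction hN : m.degree generalizing m f with
  | zero =>
    rw [(Finsupp.degree_eq_zero_iff m).1 hN, ← MvPolynomial.constantCoeff_eq,
      ← vacuum_normalOrderOne, h, map_zero]
  | succ N ih =>
    obtain ⟨i, hi⟩ : ∃ i, m i ≠ 0 := by
      by_contra! h0
      rw [show m = 0 from Finsupp.ext h0, map_zero] at hN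
      omega
    have hm : m - Finsupp.single i 1 + Finsupp.single i 1 = m :=
      tsub_add_cancel_of_le (Finsupp.single_le_iff.2 (Nat.one_le_iff_ne_zero.2 hi))
    have h1 := ih (m - Finsupp.single i 1)
      (normalOrderOne_pderiv_eq_zero (f := f) (fun g => by rw [h]; exact Commute.zero_right _) i)
      (by
        rw [← hm, map_add, Finsupp.degree_single] at hN
        omega)
    rw [MvPolynomial.coeff_pderiv, hm] at h1
    exact (mul_eq_zero.1 h1).resolve_right (Nat.cast_add_one_ne_zero _)

/-- The center of the Weyl–Heisenberg algebra consists of the scalars. -/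
theorem eq_algebraMap_vacuum_of_commute [CharZero k] {z : Heisenberg k}
    (h : ∀ g, Commute (heisenbergGen g) z) : z = algebraMap k (Heisenberg k) (vacuum z) := by
  obtain ⟨f, rfl⟩ := normalOrderOne_surjective z
  -- If the image of f is central, both partial derivatives of f lie in the kernel of normal
  -- ordering, which is zero; so f is constant in characteristic zero.
  have hf : f = MvPolynomial.C (MvPolynomial.constantCoeff f) := by
    ext m
    rw [MvPolynomial.coeff_C]
    split_ifs with hm
    · rw [← hm, MvPolynomial.constantCoeff_eq]
    · obtain ⟨i, hi⟩ := Finsupp.ne_iff.1 (Ne.symm hm)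
      have h1 := coeff_eq_zero_of_normalOrderOne_eq_zero (m - Finsupp.single i 1)
        (normalOrderOne_pderiv_eq_zero h i)
      rw [MvPolynomial.coeff_pderiv, tsub_add_cancel_of_le (Finsupp.single_le_iff.2
        (Nat.one_le_iff_ne_zero.2 hi))] at h1
      exact (mul_eq_zero.1 h1).resolve_right (Nat.cast_add_one_ne_zero _)
  rw [vacuum_normalOrderOne]
  conv_lhs => rw [hf, ← mul_one (MvPolynomial.C _), ← MvPolynomial.smul_eq_C_mul, map_smul,
    normalOrderOne_one]
  rw [Algebra.algebraMap_eq_smul_one]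

end Vacuum

/-! ### Contractions of Gaussian elements -/

section Contraction

/-- Jacobi's formula for the derivative of a determinant. -/
theorem derivation_det {k R ι : Type*} [CommRing k] [CommRing R] [Algebra k R] [Fintype ι]
    [DecidableEq ι] (δ : Derivation k R R) (M : Matrix ι ι R) :
    δ M.det = (M.adjugate * M.map δ).trace := by
  have hprod (s : Finset ι) (f : ι → R) :
      δ (∏ i ∈ s, f i) = ∑ i ∈ s, δ (f i) * ∏ j ∈ s.erase i, f j := by
    induction s using Finset.induction_on with
    | empty => simp
    | insert a s ha ih =>
      rw [Finset.prod_insert ha, Derivation.leibniz, ih, Finset.sum_insert ha,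
        Finset.erase_insert ha, smul_eq_mul, smul_eq_mul, Finset.mul_sum, add_comm,
        mul_comm (∏ i ∈ s, f i)]
      congr 1
      refine Finset.sum_congr rfl fun i hi => ?_
      have hne : a ≠ i := fun h => ha (h ▸ hi)
      rw [Finset.erase_insert_of_ne hne, Finset.prod_insert (fun h => ha (Finset.mem_of_mem_erase h))]
      ring
  -- By Cramer's rule the i-th diagonal entry is the determinant with its i-th column
  -- differentiated, so the trace is the Leibniz expansion by columns.
  have hcol (i : ι) : (M.adjugate * M.map δ) i i = (M.updateCol i fun j => δ (M j i)).det := by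
    rw [← Matrix.cramer_apply, Matrix.cramer_eq_adjugate_mulVec]
    rfl
  rw [Matrix.trace, Finset.sum_congr rfl fun i _ => (Matrix.diag_apply _ i).trans (hcol i)]
  simp only [Matrix.det_apply, map_sum]
  rw [Finset.sum_comm]
  refine Finset.sum_congr rfl fun σ _ => ?_
  rw [Units.smul_def, map_zsmul, hprod, Finset.smul_sum]
  refine Finset.sum_congr rfl fun i _ => ?_
  rw [Units.smul_def, ← Finset.mul_prod_erase _ _ (Finset.mem_univ i), Matrix.updateCol_self]
  congr 2
  refine Finset.prod_congr rfl fun j hj => ?_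
  rw [Matrix.updateCol_ne (Finset.ne_of_mem_erase hj)]

variable {k : Type*} [Field k] {A B : Type*} [Ring A] [Algebra k A] [Ring B] [Algebra k B] {m : ℕ}

/-- `F` is compatible with moving the elements `Y i` along the legs `0, 1, …, m`, where the legs
are multiplied from right to left. -/
structure IsContraction (F : B →ₗ[k] A) (y : A) (Y : Fin (m + 1) → B) : Prop where
  castSucc : ∀ (i : Fin m) b, F (Y i.castSucc * b) = F (b * Y i.succ)
  last : ∀ b, F (Y (Fin.last m) * b) = y * F b
  zero : ∀ b, F (b * Y 0) = F b * y

namespace IsContraction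

variable {F : B →ₗ[k] A} {y : A} {Y : Fin (m + 1) → B} (h : IsContraction F y Y)
include h

theorem deform_castSucc (i : Fin m) (b : PowerSeries B) :
    deform F (PowerSeries.C (Y i.castSucc) * b) = deform F (b * PowerSeries.C (Y i.succ)) := by
  ext d
  rw [coeff_deform, coeff_deform, PowerSeries.coeff_C_mul, PowerSeries.coeff_mul_C, h.castSucc]

theorem deform_last (b : PowerSeries B) :
    deform F (PowerSeries.C (Y (Fin.last m)) * b) = PowerSeries.C y * deform F b := by
  ext d
  rw [coeff_deform, PowerSeries.coeff_C_mul, PowerSeries.coeff_C_mul, coeff_deform, h.last]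

theorem deform_zero (b : PowerSeries B) :
    deform F (b * PowerSeries.C (Y 0)) = deform F b * PowerSeries.C y := by
  ext d
  rw [coeff_deform, PowerSeries.coeff_mul_C, PowerSeries.coeff_mul_C, coeff_deform, h.zero]

end IsContraction

/-- The matrix with ones directly above the diagonal. -/
def shiftMatrix (k : Type*) [Field k] (m : ℕ) :
    Matrix (Fin (m + 1)) (Fin (m + 1)) (PowerSeries k) :=
  ∑ a : Fin m, Matrix.single a.castSucc a.succ 1

theorem shiftMatrix_apply_zero (i : Fin (m + 1)) : shiftMatrix k m i 0 = 0 := by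
  simp [shiftMatrix, Matrix.sum_apply, Fin.succ_ne_zero]

theorem shiftMatrix_apply_succ (i : Fin (m + 1)) (a : Fin m) :
    shiftMatrix k m i a.succ = if a.castSucc = i then 1 else 0 := by
  rw [shiftMatrix, Matrix.sum_apply, Finset.sum_eq_single a]
  · simp [Matrix.single_apply]
  · intro b _ hb
    simp [hb]
  · simp

theorem mul_shiftMatrix_zero (Q : Matrix (Fin (m + 1)) (Fin (m + 1)) (PowerSeries k))
    (i : Fin (m + 1)) : (Q * shiftMatrix k m) i 0 = 0 := by
  simp [Matrix.mul_apply, shiftMatrix_apply_zero]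

theorem mul_shiftMatrix_succ (Q : Matrix (Fin (m + 1)) (Fin (m + 1)) (PowerSeries k))
    (i : Fin (m + 1)) (a : Fin m) : (Q * shiftMatrix k m) i a.succ = Q i a.castSucc := by
  simp [Matrix.mul_apply, shiftMatrix_apply_succ]

theorem shiftMatrix_mul_last (Q : Matrix (Fin (m + 1)) (Fin (m + 1)) (PowerSeries k))
    (j : Fin (m + 1)) : (shiftMatrix k m * Q) (Fin.last m) j = 0 := by
  rw [Matrix.mul_apply, Fin.sum_univ_succ]
  simp [shiftMatrix_apply_zero, shiftMatrix_apply_succ, Fin.castSucc_ne_last]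

theorem shiftMatrix_mul_castSucc (Q : Matrix (Fin (m + 1)) (Fin (m + 1)) (PowerSeries k))
    (a : Fin m) (j : Fin (m + 1)) : (shiftMatrix k m * Q) a.castSucc j = Q a.succ j := by
  rw [Matrix.mul_apply, Fin.sum_univ_succ]
  simp [shiftMatrix_apply_zero, shiftMatrix_apply_succ]

theorem shiftMatrix_map_derivative :
    (shiftMatrix k m).map (PowerSeries.derivative k) = 0 := by
  ext i j : 1
  simp only [shiftMatrix, Matrix.map_apply, Matrix.sum_apply, map_sum, Matrix.single_apply,
    Matrix.zero_apply]
  refine Finset.sum_eq_zero fun a _ => ?_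
  split_ifs <;> simp

/-- The matrix `1 - Qᵀ S`, where `S` has ones directly above the diagonal. -/
def contractionMatrix (Q : Matrix (Fin (m + 1)) (Fin (m + 1)) (PowerSeries k)) :
    Matrix (Fin (m + 1)) (Fin (m + 1)) (PowerSeries k) :=
  1 - Q.transpose * shiftMatrix k m

variable {Q : Matrix (Fin (m + 1)) (Fin (m + 1)) (PowerSeries k)}

/-- At h = 0 the matrix is 1 - S, which is upper unitriangular. -/
theorem constantCoeff_det_contractionMatrix (hQ : Q.map PowerSeries.constantCoeff = 1) :
    PowerSeries.constantCoeff (contractionMatrix Q).det = 1 := by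
  have hQ' (i j) : PowerSeries.constantCoeff (Q i j) = (1 : Matrix _ _ k) i j :=
    congrFun (congrFun hQ i) j
  have hentry (i j) (hij : j ≤ i) : PowerSeries.constantCoeff (contractionMatrix Q i j) =
      if i = j then 1 else 0 := by
    rw [contractionMatrix, Matrix.sub_apply, Matrix.one_apply, map_sub]
    have h0 : PowerSeries.constantCoeff ((Q.transpose * shiftMatrix k m) i j) = 0 := by
      cases j using Fin.cases with
      | zero => rw [mul_shiftMatrix_zero, map_zero]
      | succ a =>
        rw [mul_shiftMatrix_succ, Matrix.transpose_apply, hQ', Matrix.one_apply_ne]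
        intro h
        rw [← h] at hij
        exact absurd hij (not_le.2 (Fin.castSucc_lt_succ (i := a)))
    rw [h0, sub_zero]
    split_ifs <;> simp
  rw [RingHom.map_det, Matrix.det_of_isUpperTriangular]
  · refine Finset.prod_eq_one fun i _ => ?_
    simpa using hentry i i le_rfl
  · intro i j hij
    have := hentry i j (le_of_lt hij)
    exact this.trans (if_neg (ne_of_gt hij))

namespace IsGaussian

variable {F : B →ₗ[k] A} {x p : A} {xs ps : Fin (m + 1) → B} {G : PowerSeries B}

/-- Put θ_i = F(G p_i). Sliding p from one leg to the next says that the row vector θ B is θ_0 in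
position 0 and zero elsewhere. Pairing it with e evaluates to θ_0, because e_0 = 1, and to θ_last,
because B e is the last basis vector. These two are F(G) p and p F(G), the latter because the last
row of Q is trivial. -/
theorem commute_p (hG : IsGaussian xs ps G Q) (hp : IsContraction F p ps)
    (hlast : ∀ j, Q (Fin.last m) j = if j = Fin.last m then 1 else 0)
    {e : Fin (m + 1) → PowerSeries k} (he0 : e 0 = 1)
    (he : ∀ i, ∑ j, contractionMatrix Q i j * e j = if i = Fin.last m then 1 else 0) :
    Commute (PowerSeries.C p) (deform F G) := by
  have h1 (i) : deform F (PowerSeries.C (ps i) * G) =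
      ∑ j, Q i j • deform F (G * PowerSeries.C (ps j)) := by
    rw [hG.p_mul, deform_sum]
    simp only [deform_smul]
  set θ : Fin (m + 1) → PowerSeries A := fun i => deform F (G * PowerSeries.C (ps i)) with hθ
  have hl : PowerSeries.C p * deform F G = θ (Fin.last m) := by
    rw [← hp.deform_last, h1]
    simp [hlast, hθ]
  have h0 : deform F G * PowerSeries.C p = θ 0 := (hp.deform_zero G).symm
  have hB (i : Fin (m + 1)) : ∑ j, contractionMatrix Q j i • θ j = if i = 0 then θ 0 else 0 := by
    simp only [contractionMatrix, Matrix.sub_apply, sub_smul, Finset.sum_sub_distrib]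
    cases i using Fin.cases with
    | zero => simp [mul_shiftMatrix_zero, Matrix.one_apply]
    | succ a =>
      simp only [mul_shiftMatrix_succ, Matrix.transpose_apply, ← h1, hθ, hp.deform_castSucc]
      simp [Matrix.one_apply, Fin.succ_ne_zero]
  have h2 : ∑ i, e i • ∑ j, contractionMatrix Q j i • θ j = θ 0 := by
    simp [hB, he0]
  have h3 : ∑ i, e i • ∑ j, contractionMatrix Q j i • θ j = θ (Fin.last m) := by
    simp only [Finset.smul_sum, smul_smul]
    rw [Finset.sum_comm]
    simp only [mul_comm (e _), ← Finset.sum_smul, he]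
    simp
  rw [Commute, SemiconjBy, hl, h0, ← h2, h3]

/-- Put η_i = F(G x_i). Sliding x along the legs gives B η = x F(G) in the last position, and e · x
F(G) solves the same system. As B is invertible, the two agree; their components at 0 are F(G) x and
x F(G). -/
theorem commute_x (hG : IsGaussian xs ps G Q) (hx : IsContraction F x xs)
    (hlast : ∀ j, Q (Fin.last m) j = if j = Fin.last m then 1 else 0)
    {e : Fin (m + 1) → PowerSeries k} (he0 : e 0 = 1)
    (he : ∀ i, ∑ j, contractionMatrix Q i j * e j = if i = Fin.last m then 1 else 0) :
    Commute (PowerSeries.C x) (deform F G) := by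
  set η : Fin (m + 1) → PowerSeries A := fun i => deform F (G * PowerSeries.C (xs i)) with hη
  have h1 (i) : η i = ∑ a : Fin m, Q a.castSucc i • η a.succ +
      if i = Fin.last m then PowerSeries.C x * deform F G else 0 := by
    simp only [hη]
    rw [hG.mul_x, deform_sum, Fin.sum_univ_castSucc]
    simp only [deform_smul, hx.deform_castSucc, hx.deform_last, hlast]
    split_ifs <;> simp
  have hB (i : Fin (m + 1)) : ∑ j, contractionMatrix Q i j • η j =
      if i = Fin.last m then PowerSeries.C x * deform F G else 0 := by
    simp only [contractionMatrix, Matrix.sub_apply, sub_smul, Finset.sum_sub_distrib]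
    rw [Fin.sum_univ_succ (fun j => (Q.transpose * shiftMatrix k m) i j • η j)]
    simp only [mul_shiftMatrix_zero, mul_shiftMatrix_succ, Matrix.transpose_apply, zero_smul,
      zero_add]
    rw [sub_eq_iff_eq_add', ← h1]
    simp [Matrix.one_apply]
  set ζ : Fin (m + 1) → PowerSeries A := fun i => η i - e i • (PowerSeries.C x * deform F G) with hζ
  have hBζ (i : Fin (m + 1)) : ∑ j, contractionMatrix Q i j • ζ j = 0 := by
    simp only [hζ, smul_sub, Finset.sum_sub_distrib, hB, smul_smul, ← Finset.sum_smul, he]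
    split_ifs <;> simp
  have hdet : IsUnit (contractionMatrix Q).det := by
    rw [PowerSeries.isUnit_iff_constantCoeff,
      constantCoeff_det_contractionMatrix hG.constantCoeff_matrix]
    exact isUnit_one
  have h2 : ζ 0 = 0 := by
    have h3 : ∑ i, (contractionMatrix Q)⁻¹ 0 i • ∑ j, contractionMatrix Q i j • ζ j = ζ 0 := by
      simp only [Finset.smul_sum, smul_smul]
      rw [Finset.sum_comm]
      simp only [← Finset.sum_smul, ← Matrix.mul_apply, Matrix.nonsing_inv_mul _ hdet]
      simp [Matrix.one_apply]
    rw [← h3]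
    simp [hBζ]
  have h4 : η 0 = deform F G * PowerSeries.C x := hx.deform_zero G
  rw [Commute, SemiconjBy, ← h4]
  simp only [hζ, he0, one_smul, sub_eq_zero] at h2
  exact h2.symm

/-- The value ω is found from a differential equation. The two-point values r = ⟨G x_i p_j⟩ and n =
⟨x_i G p_j⟩ satisfy r = Qᵀ n and n = S (r + ω), hence B (r + ω) = ω. The equation for G' gives ω' =
tr(Q'ᵀ n) = ω tr(Q'ᵀ S B⁻¹), and by Jacobi's formula this is -ω (det B)' / det B. The constant term
fixes ω det B = 1. -/
theorem functional_mul_det [CharZero k] (hG : IsGaussian xs ps G Q) (hx : IsContraction F x xs)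
    (hcomm : ∀ i j, ps i * xs j = xs j * ps i + if i = j then 1 else 0) {v : A →ₗ[k] k}
    (hv : ∀ a, v (x * a) = 0) (hv1 : v (F 1) = 1) :
    deform v (deform F G) * (contractionMatrix Q).det = 1 := by
  set S := shiftMatrix k m with hS
  set ω : PowerSeries k := deform v (deform F G) with hω
  let r : Matrix (Fin (m + 1)) (Fin (m + 1)) (PowerSeries k) := Matrix.of fun i j =>
    deform v (deform F (G * PowerSeries.C (xs i) * PowerSeries.C (ps j)))
  let n : Matrix (Fin (m + 1)) (Fin (m + 1)) (PowerSeries k) := Matrix.of fun i j =>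
    deform v (deform F (PowerSeries.C (xs i) * G * PowerSeries.C (ps j)))
  have hr : r = Q.transpose * n := by
    ext i j : 1
    simp only [r, n, Matrix.of_apply, Matrix.mul_apply, Matrix.transpose_apply]
    rw [hG.mul_x, Finset.sum_mul, deform_sum, deform_sum]
    simp only [smul_mul_assoc, deform_smul F, deform_functional_smul v]
  -- On the last leg x leaves the word on the left and is killed by v. On any other leg it slides to
  -- the right end of the next leg, and passing p_j there produces the summand ω on the diagonal.
  have hn : n = S * (r + ω • 1) := by
    ext i j : 1
    cases i using Fin.lastCases with
    | last =>
      rw [hS, shiftMatrix_mul_last]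
      simp only [n, Matrix.of_apply, mul_assoc, hx.deform_last]
      refine PowerSeries.ext fun d => ?_
      rw [coeff_deform, PowerSeries.coeff_C_mul, hv, map_zero]
    | cast a =>
      rw [hS, shiftMatrix_mul_castSucc]
      simp only [n, r, Matrix.of_apply, mul_assoc, hx.deform_castSucc, Matrix.add_apply,
        Matrix.smul_apply]
      have hc : PowerSeries.C (ps j) * PowerSeries.C (xs a.succ) =
          PowerSeries.C (xs a.succ) * PowerSeries.C (ps j) + if j = a.succ then 1 else 0 := by
        rw [← map_mul, hcomm, map_add, map_mul]
        split_ifs <;> simp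
      rw [hc, mul_add, deform_add, deform_add]
      congr 1
      rw [Matrix.one_apply]
      by_cases hj : a.succ = j
      · simp [hj, hω]
      · rw [if_neg (Ne.symm hj), if_neg hj, mul_zero, smul_zero]
        ext d
        simp [coeff_deform]
  have hdω : PowerSeries.derivative k ω =
      ((Q.map (PowerSeries.derivative k)).transpose * n).trace := by
    have h1 : PowerSeries.derivative k ω = hderiv ω := by
      ext d
      rw [PowerSeries.coeff_derivative, coeff_hderiv, nsmul_eq_mul, mul_comm]
      simp
    rw [h1, hω, ← deform_hderiv, ← deform_hderiv, hG.hderiv_eq, deform_sum, deform_sum]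
    simp only [deform_sum, deform_smul F, deform_functional_smul v, Matrix.trace, Matrix.diag_apply,
      Matrix.mul_apply, Matrix.transpose_apply, Matrix.map_apply, n, Matrix.of_apply]
    rw [Finset.sum_comm]
  have hB : contractionMatrix Q * (r + ω • 1) = ω • 1 := by
    rw [contractionMatrix, sub_mul, one_mul, mul_assoc, ← hS, ← hn, ← hr, add_sub_cancel_left]
  -- The adjugate replaces the inverse of B, so that no division is needed.
  have hadj : (contractionMatrix Q).det • (r + ω • 1) = ω • (contractionMatrix Q).adjugate := by
    have := congrArg (fun M => (contractionMatrix Q).adjugate * M) hB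
    simpa [← mul_assoc, Matrix.adjugate_mul] using this
  have hdB : (contractionMatrix Q).map (PowerSeries.derivative k) =
      -((Q.map (PowerSeries.derivative k)).transpose * S) := by
    ext i j : 1
    rw [contractionMatrix, Matrix.map_apply, Matrix.sub_apply, map_sub,
      derivative_matrix_mul_apply, Matrix.neg_apply, Matrix.mul_apply]
    have h1 : PowerSeries.derivative k
        ((1 : Matrix (Fin (m + 1)) (Fin (m + 1)) (PowerSeries k)) i j) = 0 := by
      rw [Matrix.one_apply]
      split_ifs <;> simp
    have h2 (l) : PowerSeries.derivative k (shiftMatrix k m l j) = 0 :=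
      congrFun (congrFun shiftMatrix_map_derivative l) j
    simp [h1, h2, hS]
  have hconst : PowerSeries.derivative k (ω * (contractionMatrix Q).det) = 0 := by
    have h1 : (contractionMatrix Q).det * PowerSeries.derivative k ω =
        ω * ((Q.map (PowerSeries.derivative k)).transpose * S *
          (contractionMatrix Q).adjugate).trace := by
      have h2 := congrArg (fun M => ((Q.map (PowerSeries.derivative k)).transpose * S * M).trace) hadj
      simp only [Matrix.mul_smul, Matrix.trace_smul, smul_eq_mul] at h2
      rw [hdω, hn, ← mul_assoc, h2]
    rw [Derivation.leibniz, smul_eq_mul, smul_eq_mul, h1, derivation_det, hdB, Matrix.mul_neg,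
      Matrix.trace_neg, Matrix.trace_mul_comm]
    ring
  apply PowerSeries.derivative.ext
  · rw [hconst, PowerSeries.derivative_one]
  · have h0 : PowerSeries.constantCoeff ω = 1 := by
      rw [hω, ← PowerSeries.coeff_zero_eq_constantCoeff_apply, coeff_deform, coeff_deform,
        PowerSeries.coeff_zero_eq_constantCoeff_apply, hG.constantCoeff_eq, hv1]
    rw [map_mul, h0, constantCoeff_det_contractionMatrix hG.constantCoeff_matrix, map_one, one_mul]

end IsGaussian

end Contraction

/-! ### The Alexander numbering of the edges of an upward diagram -/

section AlexanderNumbering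

/-- The index of the region to the right of a word of strands, if the region to its left has
index zero. -/
def regionShift : List Strand → ℤ
  | [] => 0
  | s :: w => (if s.up then -1 else 1) + regionShift w

/-- The upward strands of a word, each with the index of the region to its left in the direction of
the strand, if the leftmost region has index `c`. -/
def upStrands : ℤ → List Strand → Multiset (ℕ × ℤ)
  | _, [] => 0
  | c, ⟨a, _, true⟩ :: w => {(a, c)} + upStrands (c - 1) w
  | c, ⟨_, _, false⟩ :: w => upStrands (c + 1) w

/-- The downward strands of a word, each with the index of the region to its left in the direction
of the strand, if the leftmost region has index `c`. -/
def downStrands : ℤ → List Strand → Multiset (ℕ × ℤ)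
  | _, [] => 0
  | c, ⟨_, _, true⟩ :: w => downStrands (c - 1) w
  | c, ⟨a, _, false⟩ :: w => {(a, c + 1)} + downStrands (c + 1) w

theorem upStrands_append (c : ℤ) (l r : List Strand) :
    upStrands c (l ++ r) = upStrands c l + upStrands (c + regionShift l) r := by
  induction l generalizing c with
  | nil => simp [upStrands, regionShift]
  | cons s l ih =>
    rcases s with ⟨a, u, _ | _⟩ <;>
      simp [upStrands, regionShift, ih, add_assoc, sub_eq_add_neg]

theorem downStrands_append (c : ℤ) (l r : List Strand) :
    downStrands c (l ++ r) = downStrands c l + downStrands (c + regionShift l) r := by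
  induction l generalizing c with
  | nil => simp [downStrands, regionShift]
  | cons s l ih =>
    rcases s with ⟨a, u, _ | _⟩ <;>
      simp [downStrands, regionShift, ih, add_assoc, sub_eq_add_neg]

/-- The incoming strands of a list of crossings, where each crossing comes with the index of the
region to the left of its incoming over-strand. -/
def incomingStrands (L : List (Crossing × ℤ)) : Multiset (ℕ × ℤ) :=
  (L.map fun q => ({(q.1.overEdge, q.2)} + {(q.1.underEdge, q.2 - q.1.sign)} :
    Multiset (ℕ × ℤ))).sum

/-- The outgoing strands of a list of crossings, where each crossing comes with the index of the
region to the left of its incoming over-strand. -/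
def outgoingStrands (L : List (Crossing × ℤ)) : Multiset (ℕ × ℤ) :=
  (L.map fun q => ({(q.1.underEdge + 1, q.2)} + {(q.1.overEdge + 1, q.2 - q.1.sign)} :
    Multiset (ℕ × ℤ))).sum

/-- This is the Alexander numbering as a balance of labelled ends: the region to the left of a
strand stays the same along an edge. The beginnings of edges and the downward points of the
horizontal line then match the ends of edges and its upward points, as multisets. This form is
stable under each elementary step. -/
theorem UpwardTangle.exists_regions {w : List Strand} (d : UpwardTangle w) :
    ∃ L : List (Crossing × ℤ), L.map Prod.fst = d.crossings ∧
      {(0, 0)} + outgoingStrands L + downStrands 0 w = incomingStrands L + upStrands 0 w := by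
  induction d with
  | start => exact ⟨[], rfl, by simp [outgoingStrands, incomingStrands, downStrands, upStrands]⟩
  | @crossing pos l r a b u v d ih =>
    obtain ⟨L, hL, h⟩ := ih
    simp only [upStrands_append, downStrands_append, upStrands, downStrands] at h ⊢
    cases pos with
    | true =>
      refine ⟨(⟨true, a, b⟩, 0 + regionShift l) :: L, by simp [hL, crossings], ?_⟩
      simp only [outgoingStrands, incomingStrands, List.map_cons, List.sum_cons, Crossing.sign,
        if_true] at h ⊢
      convert congrArg (fun s => {(b + 1, 0 + regionShift l)} +
        {(a + 1, 0 + regionShift l - 1)} + s) h using 1 <;> abel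
    | false =>
      -- In a negative crossing the over-strand comes from the lower right, so the index to its left
      -- is one less than that of the region left of the crossing.
      refine ⟨(⟨false, b, a⟩, 0 + regionShift l - 1) :: L, by simp [hL, crossings], ?_⟩
      simp only [outgoingStrands, incomingStrands, List.map_cons, List.sum_cons, Crossing.sign,
        Bool.false_eq_true, if_false, sub_neg_eq_add, sub_add_cancel] at h ⊢
      convert congrArg (fun s => {(b + 1, 0 + regionShift l)} +
        {(a + 1, 0 + regionShift l - 1)} + s) h using 1 <;> abel
  | @maxLeft l r a u d ih =>
    obtain ⟨L, hL, h⟩ := ih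
    refine ⟨L, hL, ?_⟩
    simp only [upStrands_append, downStrands_append, upStrands, downStrands,
      add_sub_cancel_right] at h ⊢
    -- The two points joined by the maximum have the same edge and the same region to their left, so
    -- they cancel.
    refine add_left_cancel (a := {(a, 0 + regionShift l + 1)}) ?_
    convert h using 1 <;> abel
  | @maxRight l r a u d ih =>
    obtain ⟨L, hL, h⟩ := ih
    refine ⟨L, hL, ?_⟩
    simp only [upStrands_append, downStrands_append, upStrands, downStrands,
      sub_add_cancel] at h ⊢
    refine add_left_cancel (a := {(a, 0 + regionShift l)}) ?_
    convert h using 1 <;> abel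
  | @minRight l r a u d ih =>
    obtain ⟨L, hL, h⟩ := ih
    refine ⟨L, hL, ?_⟩
    simp only [upStrands_append, downStrands_append, upStrands, downStrands,
      add_sub_cancel_right] at h ⊢
    convert congrArg (fun s => {(a, 0 + regionShift l + 1)} + s) h using 1 <;> abel
  | @minLeft l r a u d ih =>
    obtain ⟨L, hL, h⟩ := ih
    refine ⟨L, hL, ?_⟩
    simp only [upStrands_append, downStrands_append, upStrands, downStrands,
      sub_add_cancel] at h ⊢
    convert congrArg (fun s => {(a, 0 + regionShift l)} + s) h using 1 <;> abel

/-- Comparing multiplicities of 0 and of e + 1 shows that the multiplicity in E starts at 1, is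
constant, and drops to 0 exactly at n; for n = 0 it is 0 from the start. -/
theorem multiset_eq_range {E : Multiset ℕ} {n : ℕ} (h : {0} + E.map (· + 1) = E + {n}) :
    E = Multiset.range n := by
  have hcount (e : ℕ) : E.count e = if e < n then 1 else 0 := by
    induction e with
    | zero =>
      have := congrArg (Multiset.count 0) h
      have h0 : Multiset.count 0 (E.map (· + 1)) = 0 := Multiset.count_eq_zero.2 (by simp)
      rw [Multiset.count_add, Multiset.count_add, h0, Multiset.count_singleton,
        Multiset.count_singleton] at this
      split_ifs at * <;> omega
    | succ e ih =>
      have := congrArg (Multiset.count (e + 1)) h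
      rw [Multiset.count_add, Multiset.count_add,
        Multiset.count_map_eq_count' _ _ (add_left_injective 1), Multiset.count_singleton,
        Multiset.count_singleton, ih] at this
      split_ifs at * <;> omega
  ext e
  rw [hcount]
  split_ifs with he
  · rw [Multiset.count_eq_one_of_mem (Multiset.nodup_range n) (Multiset.mem_range.2 he)]
  · rw [Multiset.count_eq_zero.2 (fun h => he (Multiset.mem_range.1 h))]

/-- The incoming edges of the crossings of a diagram. -/
def incomingEdges (cs : List Crossing) : List ℕ :=
  cs.flatMap fun c => [c.overEdge, c.underEdge]

theorem map_fst_incomingStrands (L : List (Crossing × ℤ)) :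
    (incomingStrands L).map Prod.fst = incomingEdges (L.map Prod.fst) := by
  induction L with
  | nil => rfl
  | cons q L ih =>
    rw [incomingStrands, List.map_cons, List.sum_cons, Multiset.map_add, ← incomingStrands, ih]
    rfl

theorem map_fst_outgoingStrands (L : List (Crossing × ℤ)) :
    (outgoingStrands L).map Prod.fst = ((incomingStrands L).map Prod.fst).map (· + 1) := by
  induction L with
  | nil => rfl
  | cons q L ih =>
    rw [outgoingStrands, incomingStrands, List.map_cons, List.map_cons, List.sum_cons,
      List.sum_cons, Multiset.map_add, ← outgoingStrands, ← incomingStrands, ih, Multiset.map_add,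
      Multiset.map_add]
    simp [add_comm]

theorem mem_incomingStrands {L : List (Crossing × ℤ)} {q : Crossing × ℤ} (hq : q ∈ L) :
    (q.1.overEdge, q.2) ∈ incomingStrands L ∧
      (q.1.underEdge, q.2 - q.1.sign) ∈ incomingStrands L := by
  have h := List.single_le_sum (M := Multiset (ℕ × ℤ)) (fun _ _ => Multiset.zero_le _)
    _ (List.mem_map_of_mem (f := fun q : Crossing × ℤ =>
      ({(q.1.overEdge, q.2)} + {(q.1.underEdge, q.2 - q.1.sign)} : Multiset (ℕ × ℤ))) hq)
  exact ⟨Multiset.mem_of_le h (by simp), Multiset.mem_of_le h (by simp)⟩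

theorem mem_outgoingStrands {L : List (Crossing × ℤ)} {q : Crossing × ℤ} (hq : q ∈ L) :
    (q.1.underEdge + 1, q.2) ∈ outgoingStrands L ∧
      (q.1.overEdge + 1, q.2 - q.1.sign) ∈ outgoingStrands L := by
  have h := List.single_le_sum (M := Multiset (ℕ × ℤ)) (fun _ _ => Multiset.zero_le _)
    _ (List.mem_map_of_mem (f := fun q : Crossing × ℤ =>
      ({(q.1.underEdge + 1, q.2)} + {(q.1.overEdge + 1, q.2 - q.1.sign)} :
        Multiset (ℕ × ℤ))) hq)
  exact ⟨Multiset.mem_of_le h (by simp), Multiset.mem_of_le h (by simp)⟩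

namespace UpwardKnotDiagram

variable (D : UpwardKnotDiagram)

/-- The incoming edges of the crossings are all edges but the last one, and there is a numbering of
the edges by the indices of the regions to their left. -/
theorem incomingEdges_perm_and_exists_numbering :
    (incomingEdges D.tangle.crossings).Perm (List.range D.lastEdge) ∧
    ∃ μ : ℕ → ℤ, μ 0 = 0 ∧ μ D.lastEdge = 0 ∧ ∀ c ∈ D.tangle.crossings,
      μ (c.underEdge + 1) = μ c.overEdge ∧ μ (c.overEdge + 1) = μ c.underEdge ∧
        μ c.overEdge - μ c.underEdge = c.sign := by
  obtain ⟨L, hL, h⟩ := D.tangle.exists_regions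
  simp only [downStrands, upStrands, add_zero] at h
  have hE : (incomingStrands L).map Prod.fst = Multiset.range D.lastEdge := by
    apply multiset_eq_range
    have := congrArg (Multiset.map Prod.fst) h
    rwa [Multiset.map_add, Multiset.map_add, map_fst_outgoingStrands] at this
  constructor
  · rw [← Multiset.coe_eq_coe, ← hL, ← map_fst_incomingStrands, hE]
    rfl
  -- The multiset T contains each edge exactly once, so it is the graph of the numbering. By the
  -- balance equation it also consists of the initial strand and the outgoing strands, which gives
  -- the relations at the crossings.
  · set T := incomingStrands L + {(D.lastEdge, (0 : ℤ))} with hT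
    have hnodup : (T.map Prod.fst).Nodup := by
      rw [hT, Multiset.map_add, hE, Multiset.map_singleton, add_comm, Multiset.singleton_add,
        ← Multiset.range_succ]
      exact Multiset.nodup_range _
    have hinj := Multiset.inj_on_of_nodup_map hnodup
    classical
    let μ : ℕ → ℤ := fun e => if he : ∃ n, (e, n) ∈ T then he.choose else 0
    have hμ {e : ℕ} {n : ℤ} (hen : (e, n) ∈ T) : μ e = n := by
      have he : ∃ n, (e, n) ∈ T := ⟨n, hen⟩
      have h1 : μ e = he.choose := dif_pos he
      rw [h1]
      exact congrArg Prod.snd (hinj _ he.choose_spec _ hen rfl)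
    refine ⟨μ, hμ (by rw [← h]; simp), hμ (by simp [hT]), ?_⟩
    intro c hc
    rw [← hL, List.mem_map] at hc
    obtain ⟨q, hq, rfl⟩ := hc
    obtain ⟨h1, h2⟩ := mem_incomingStrands hq
    obtain ⟨h3, h4⟩ := mem_outgoingStrands hq
    rw [hμ (Multiset.mem_add.2 (Or.inl h1)), hμ (Multiset.mem_add.2 (Or.inl h2)),
      hμ (show _ ∈ T by rw [← h]; exact Multiset.mem_add.2 (Or.inr h3)),
      hμ (show _ ∈ T by rw [← h]; exact Multiset.mem_add.2 (Or.inr h4))]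
    exact ⟨rfl, rfl, sub_sub_cancel _ _⟩

end UpwardKnotDiagram

end AlexanderNumbering

/-! ### Placing Gaussian elements on legs -/

section Placement

variable {k : Type*} [Field k]

theorem sum_eq_sum_of_injective {κ ι : Type*} [Fintype κ] [Fintype ι] [DecidableEq ι]
    {s : κ → ι} {V : Type*} [AddCommMonoid V] (hs : Function.Injective s)
    (z : ι → V) (hz : ∀ i ∉ Set.range s, z i = 0) : ∑ i, z i = ∑ a, z (s a) := by
  rw [← Finset.sum_image (f := z) (s := Finset.univ) (g := s) fun a _ b _ h => hs h]
  refine (Finset.sum_subset (Finset.subset_univ _) fun i _ hi => hz i fun ⟨a, ha⟩ => hi ?_).symm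
  exact Finset.mem_image.2 ⟨a, Finset.mem_univ _, ha⟩

/-- The matrix that acts as `M` on the indices in the image of `s` and trivially on the others. -/
def embedMatrix {κ ι : Type*} [Fintype κ] [DecidableEq κ] [DecidableEq ι] (s : κ → ι)
    (M : Matrix κ κ (PowerSeries k)) : Matrix ι ι (PowerSeries k) :=
  1 + ∑ a, ∑ b, Matrix.single (s a) (s b) ((M - 1) a b)

section

variable {κ ι : Type*} [Fintype κ] [DecidableEq κ] [DecidableEq ι] {s : κ → ι}
  {M : Matrix κ κ (PowerSeries k)}

theorem embedMatrix_apply_apply (hs : Function.Injective s) (a b : κ) :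
    embedMatrix s M (s a) (s b) = M a b := by
  simp [embedMatrix, Matrix.sum_apply, Matrix.single_apply, hs.eq_iff, ite_and, Matrix.one_apply]

theorem embedMatrix_apply_left {i : ι} (hi : i ∉ Set.range s) (j : ι) :
    embedMatrix s M i j = (1 : Matrix ι ι (PowerSeries k)) i j := by
  have h (a : κ) : s a ≠ i := fun h => hi ⟨a, h⟩
  simp [embedMatrix, Matrix.sum_apply, h]

theorem embedMatrix_apply_right {j : ι} (hj : j ∉ Set.range s) (i : ι) :
    embedMatrix s M i j = (1 : Matrix ι ι (PowerSeries k)) i j := by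
  have h (a : κ) : s a ≠ j := fun h => hj ⟨a, h⟩
  simp [embedMatrix, Matrix.sum_apply, h]

variable [Fintype ι] {B B' : Type*} [Ring B] [Algebra k B] [Ring B'] [Algebra k B']

theorem hderiv_map (f : B' →+* B) (z : PowerSeries B') :
    hderiv (PowerSeries.map f z) = PowerSeries.map f (hderiv z) := by
  ext n
  simp [coeff_hderiv]

theorem map_smul_powerSeries (f : B' →ₐ[k] B) (c : PowerSeries k) (z : PowerSeries B') :
    PowerSeries.map (f : B' →+* B) (c • z) = c • PowerSeries.map (f : B' →+* B) z := by
  rw [← deform_algHom, ← deform_algHom, deform_smul]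

/-- Generators outside the image of s commute with everything that comes from B', so they pass
unchanged and the matrix is extended by the identity. -/
theorem IsGaussian.map {f : B' →ₐ[k] B} {x p : ι → B} {x' p' : κ → B'}
    (hs : Function.Injective s) (hx : ∀ a, f (x' a) = x (s a)) (hp : ∀ a, f (p' a) = p (s a))
    (hcx : ∀ i ∉ Set.range s, ∀ b, Commute (x i) (f b))
    (hcp : ∀ i ∉ Set.range s, ∀ b, Commute (p i) (f b)) {b : PowerSeries B'}
    (hb : IsGaussian x' p' b M) :
    IsGaussian x p (PowerSeries.map (f : B' →+* B) b) (embedMatrix s M) where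
  constantCoeff_eq := by
    rw [← PowerSeries.coeff_zero_eq_constantCoeff_apply, PowerSeries.coeff_map,
      PowerSeries.coeff_zero_eq_constantCoeff_apply, hb.constantCoeff_eq, map_one]
  constantCoeff_matrix := by
    ext i j : 1
    rw [Matrix.map_apply]
    have h1 : PowerSeries.constantCoeff ((1 : Matrix ι ι (PowerSeries k)) i j) =
        (1 : Matrix ι ι k) i j := by
      rw [Matrix.one_apply, Matrix.one_apply]
      split_ifs <;> simp
    by_cases hi : i ∈ Set.range s
    · by_cases hj : j ∈ Set.range s
      · obtain ⟨a, rfl⟩ := hi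
        obtain ⟨b, rfl⟩ := hj
        have := congrFun (congrFun hb.constantCoeff_matrix a) b
        rw [Matrix.map_apply] at this
        rw [embedMatrix_apply_apply hs, this, Matrix.one_apply, Matrix.one_apply]
        simp [hs.eq_iff]
      · rw [embedMatrix_apply_right hj, h1]
    · rw [embedMatrix_apply_left hi, h1]
  mul_x i := by
    by_cases hi : i ∈ Set.range s
    · obtain ⟨a, rfl⟩ := hi
      rw [sum_eq_sum_of_injective hs]
      · have := congrArg (PowerSeries.map (f : B' →+* B)) (hb.mul_x a)
        simpa only [map_mul, PowerSeries.map_C, RingHom.coe_coe, hx, map_sum,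
          map_smul_powerSeries, embedMatrix_apply_apply hs] using this
      · intro j hj
        rw [embedMatrix_apply_left hj, Matrix.one_apply_ne, zero_smul]
        rintro rfl
        exact hj ⟨a, rfl⟩
    · simp only [embedMatrix_apply_right hi, Matrix.one_apply]
      simp only [ite_smul, one_smul, zero_smul, Finset.sum_ite_eq', Finset.mem_univ, if_true]
      ext n
      rw [PowerSeries.coeff_mul_C, PowerSeries.coeff_C_mul, PowerSeries.coeff_map]
      exact (hcx i hi _).eq.symm
  p_mul i := by
    by_cases hi : i ∈ Set.range s
    · obtain ⟨a, rfl⟩ := hi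
      rw [sum_eq_sum_of_injective hs]
      · have := congrArg (PowerSeries.map (f : B' →+* B)) (hb.p_mul a)
        simpa only [map_mul, PowerSeries.map_C, RingHom.coe_coe, hp, map_sum,
          map_smul_powerSeries, embedMatrix_apply_apply hs] using this
      · intro j hj
        rw [embedMatrix_apply_right hj, Matrix.one_apply_ne, zero_smul]
        rintro rfl
        exact hj ⟨a, rfl⟩
    · simp only [embedMatrix_apply_left hi, Matrix.one_apply]
      simp only [ite_smul, one_smul, zero_smul, Finset.sum_ite_eq, Finset.mem_univ, if_true]
      ext n
      rw [PowerSeries.coeff_mul_C, PowerSeries.coeff_C_mul, PowerSeries.coeff_map]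
      exact (hcp i hi _).eq
  hderiv_eq := by
    have h1 (i j : ι) :
        PowerSeries.derivative k ((1 : Matrix ι ι (PowerSeries k)) i j) = 0 := by
      rw [Matrix.one_apply]
      split_ifs <;> simp
    have := congrArg (PowerSeries.map (f : B' →+* B)) hb.hderiv_eq
    rw [hderiv_map, this, sum_eq_sum_of_injective hs]
    · rw [map_sum]
      refine Finset.sum_congr rfl fun a _ => ?_
      rw [sum_eq_sum_of_injective hs]
      · simp only [map_mul, PowerSeries.map_C, RingHom.coe_coe, hp, hx, map_sum,
          map_smul_powerSeries, embedMatrix_apply_apply hs]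
      · intro j hj
        rw [embedMatrix_apply_right hj, h1, zero_smul]
    · intro i hi
      refine Finset.sum_eq_zero fun j _ => ?_
      rw [embedMatrix_apply_left hi, h1, zero_smul]

end

/-! ### Placements of tensors on legs, and contraction of all legs -/

section

variable {A : Type*} [Ring A] [Algebra k A] {I : Type*} [DecidableEq I]

theorem placeLegs_tprod (i j : I) (a : Fin 2 → A) :
    placeLegs (k := k) i j (PiTensorProduct.tprod k a) =
      PiTensorProduct.singleAlgHom (R := k) (A := fun _ : I => A) i (a 0) *
        PiTensorProduct.singleAlgHom (R := k) (A := fun _ : I => A) j (a 1) := by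
  rw [placeLegs, PiTensorProduct.lift.tprod, MultilinearMap.compLinearMap_apply,
    MultilinearMap.mkPiAlgebraFin_apply]
  simp [List.ofFn_succ]

/-- The placement on two different legs as an algebra homomorphism. -/
def placeLegsAlgHom {i j : I} (hij : i ≠ j) : (⨂[k] _ : Fin 2, A) →ₐ[k] (⨂[k] _ : I, A) :=
  PiTensorProduct.liftAlgHom
    ((MultilinearMap.mkPiAlgebraFin k 2 (⨂[k] _ : I, A)).compLinearMap
      ![(PiTensorProduct.singleAlgHom (R := k) (A := fun _ : I => A) i).toLinearMap,
        (PiTensorProduct.singleAlgHom (R := k) (A := fun _ : I => A) j).toLinearMap])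
    (by
      have := placeLegs_tprod (k := k) i j (1 : Fin 2 → A)
      rw [placeLegs, PiTensorProduct.lift.tprod] at this
      rw [this]
      simp only [Pi.one_apply, map_one, mul_one])
    (fun a b => by
      have h := placeLegs_tprod (k := k) (A := A) (I := I) i j
      simp only [placeLegs, PiTensorProduct.lift.tprod] at h
      rw [h, h, h, Pi.mul_apply, Pi.mul_apply, map_mul, map_mul]
      exact (commute_singleAlgHom (k := k) hij (b 0) (a 1)).mul_mul_mul_comm _ _)

theorem placeLegsAlgHom_apply {i j : I} (hij : i ≠ j) (z : ⨂[k] _ : Fin 2, A) :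
    placeLegsAlgHom hij z = placeLegs i j z := rfl

theorem placeLegsAlgHom_single {i j : I} (hij : i ≠ j) (a : Fin 2) (y : A) :
    placeLegsAlgHom hij (PiTensorProduct.singleAlgHom (R := k) (A := fun _ : Fin 2 => A) a y) =
      PiTensorProduct.singleAlgHom (R := k) (A := fun _ : I => A) (![i, j] a) y := by
  rw [placeLegsAlgHom_apply, PiTensorProduct.singleAlgHom_apply (i := a), placeLegs_tprod]
  fin_cases a
  · simp only [Fin.zero_eta, MonoidHom.mulSingle_apply, Pi.mulSingle_eq_same, Matrix.cons_val_zero]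
    rw [Pi.mulSingle_eq_of_ne (by decide), map_one, mul_one]
  · simp only [Fin.mk_one, MonoidHom.mulSingle_apply, Pi.mulSingle_eq_same, Matrix.cons_val_one]
    rw [Pi.mulSingle_eq_of_ne (by decide), map_one, one_mul]
    rfl

theorem commute_placeLegsAlgHom {i j l : I} (hij : i ≠ j) (hi : l ≠ i) (hj : l ≠ j) (y : A)
    (z : ⨂[k] _ : Fin 2, A) :
    Commute (PiTensorProduct.singleAlgHom (R := k) (A := fun _ : I => A) l y)
      (placeLegsAlgHom hij z) := by
  induction z using PiTensorProduct.induction_on with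
  | smul_tprod r a =>
    rw [map_smul, placeLegsAlgHom_apply, placeLegs_tprod]
    exact ((commute_singleAlgHom hi _ _).mul_right (commute_singleAlgHom hj _ _)).smul_right r
  | add z w hz hw =>
    rw [map_add]
    exact hz.add_right hw

theorem contractLegs_tprod_succ (n : ℕ) (a : Fin (n + 1) → A) :
    contractLegs (k := k) (n + 1) (PiTensorProduct.tprod k a) =
      contractLegs (k := k) n (PiTensorProduct.tprod k fun i => a i.succ) * a 0 := by
  rw [contractLegs_tprod, contractLegs_tprod, List.ofFn_succ']
  simp [Fin.rev_castSucc]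

theorem contractLegs_tprod_castSucc (n : ℕ) (a : Fin (n + 1) → A) :
    contractLegs (k := k) (n + 1) (PiTensorProduct.tprod k a) =
      a (Fin.last n) * contractLegs (k := k) n (PiTensorProduct.tprod k fun i => a i.castSucc) := by
  rw [contractLegs_tprod, contractLegs_tprod, List.ofFn_succ]
  simp [Fin.rev_succ]

/-- Both sides are the word … a_(i+1) y a_i …. The induction strips leg 0 until the two legs are the
first ones, where associativity remains. -/
theorem contractLegs_tprod_update {m : ℕ} (i : Fin m) (y : A) (a : Fin (m + 1) → A) :
    contractLegs (k := k) (m + 1)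
        (PiTensorProduct.tprod k (Function.update a i.castSucc (y * a i.castSucc))) =
      contractLegs (k := k) (m + 1)
        (PiTensorProduct.tprod k (Function.update a i.succ (a i.succ * y))) := by
  induction m with
  | zero => exact i.elim0
  | succ m ih =>
    rw [contractLegs_tprod_succ, contractLegs_tprod_succ (m + 1)]
    cases i using Fin.cases with
    | zero =>
      rw [contractLegs_tprod_succ, contractLegs_tprod_succ m]
      have h1 (v : A) : (fun j : Fin m => Function.update a (0 : Fin (m + 1)).castSucc v j.succ.succ) =
          fun j => a j.succ.succ := by
        ext j
        exact Function.update_of_ne (Fin.succ_ne_zero _) _ _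
      have h2 (v : A) : (fun j : Fin m => Function.update a (0 : Fin (m + 1)).succ v j.succ.succ) =
          fun j => a j.succ.succ := by
        ext j
        exact Function.update_of_ne (fun h => Fin.succ_ne_zero _ (Fin.succ_injective _ h)) _ _
      rw [h1, h2]
      simp [mul_assoc]
    | succ i =>
      have h1 (j : Fin (m + 1)) (v : A) : (fun l : Fin (m + 1) => Function.update a j.succ v l.succ) =
          Function.update (fun l : Fin (m + 1) => a l.succ) j v :=
        Function.update_comp_eq_of_injective a (Fin.succ_injective _) j v
      rw [← Fin.succ_castSucc, h1, h1, ih i fun l => a l.succ,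
        Function.update_of_ne (Fin.succ_ne_zero _).symm,
        Function.update_of_ne (Fin.succ_ne_zero _).symm]

theorem contractLegs_single_castSucc_mul {m : ℕ} (i : Fin m) (y : A)
    (b : ⨂[k] _ : Fin (m + 1), A) :
    contractLegs (k := k) (m + 1) (PiTensorProduct.singleAlgHom (R := k)
        (A := fun _ : Fin (m + 1) => A) i.castSucc y * b) =
      contractLegs (k := k) (m + 1) (b * PiTensorProduct.singleAlgHom (R := k)
        (A := fun _ : Fin (m + 1) => A) i.succ y) := by
  induction b using PiTensorProduct.induction_on with
  | smul_tprod r a =>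
    rw [mul_smul_comm, smul_mul_assoc, map_smul, map_smul, singleAlgHom_mul_tprod,
      tprod_mul_singleAlgHom, contractLegs_tprod_update]
  | add z w hz hw => rw [mul_add, add_mul, map_add, map_add, hz, hw]

theorem contractLegs_single_last_mul (m : ℕ) (y : A) (b : ⨂[k] _ : Fin (m + 1), A) :
    contractLegs (k := k) (m + 1) (PiTensorProduct.singleAlgHom (R := k)
        (A := fun _ : Fin (m + 1) => A) (Fin.last m) y * b) = y * contractLegs (m + 1) b := by
  induction b using PiTensorProduct.induction_on with
  | smul_tprod r a =>
    rw [mul_smul_comm, map_smul, map_smul, mul_smul_comm, singleAlgHom_mul_tprod,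
      contractLegs_tprod_castSucc, contractLegs_tprod_castSucc, Function.update_self, mul_assoc]
    congr 5
    ext i
    exact Function.update_of_ne (Fin.castSucc_ne_last i) _ _
  | add z w hz hw => rw [mul_add, map_add, map_add, hz, hw, mul_add]

theorem contractLegs_mul_single_zero (m : ℕ) (y : A) (b : ⨂[k] _ : Fin (m + 1), A) :
    contractLegs (k := k) (m + 1) (b * PiTensorProduct.singleAlgHom (R := k)
        (A := fun _ : Fin (m + 1) => A) 0 y) = contractLegs (m + 1) b * y := by
  induction b using PiTensorProduct.induction_on with
  | smul_tprod r a =>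
    rw [smul_mul_assoc, map_smul, map_smul, smul_mul_assoc, tprod_mul_singleAlgHom,
      contractLegs_tprod_succ, contractLegs_tprod_succ, Function.update_self, mul_assoc]
    congr 5
  | add z w hz hw => rw [add_mul, map_add, map_add, hz, hw, add_mul]

theorem isContraction_contractLegs (m : ℕ) (y : A) :
    IsContraction (contractLegs (k := k) (m + 1)) y
      (fun i => PiTensorProduct.singleAlgHom (R := k) (A := fun _ : Fin (m + 1) => A) i y) where
  castSucc i b := contractLegs_single_castSucc_mul i y b
  last b := contractLegs_single_last_mul m y b
  zero b := contractLegs_mul_single_zero m y b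

theorem contractLegs_map_one (n : ℕ) :
    contractLegs (k := k) n (1 : ⨂[k] _ : Fin n, A) = 1 := by
  rw [PiTensorProduct.one_def, contractLegs_tprod]
  simp

end

end Placement

/-! ### The universal invariant of an upward diagram -/

section UniversalInvariantComputation

variable {k : Type*} [Field k] [CharZero k]

/-- The matrix `[[u, 0], [1 - u², u]]`. -/
def crossingGaussianMatrix (u : (PowerSeries k)ˣ) : Matrix (Fin 2) (Fin 2) (PowerSeries k) :=
  !![(u : PowerSeries k), 0; 1 - (u : PowerSeries k) ^ 2, u]

omit [CharZero k] in
-- The inverse has the same shape with T⁻¹ for T, so both signs of crossings are covered by u = T^s.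
theorem crossingGaussianMatrix_mul_inv (u : (PowerSeries k)ˣ) :
    crossingGaussianMatrix u * crossingGaussianMatrix u⁻¹ = 1 := by
  ext i j : 1
  have h := u.mul_inv
  fin_cases i <;> fin_cases j <;>
    simp [crossingGaussianMatrix, Matrix.mul_apply, Fin.sum_univ_two]
  linear_combination (-(u : PowerSeries k) - (↑u⁻¹ : PowerSeries k)) * h

theorem constantCoeff_expT (t : k) :
    PowerSeries.constantCoeff (expT t : PowerSeries k) = 1 := by
  change PowerSeries.constantCoeff (PowerSeries.rescale t (PowerSeries.exp k)) = 1
  rw [← PowerSeries.coeff_zero_eq_constantCoeff_apply, PowerSeries.coeff_rescale]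
  simp

theorem isGaussian_heisenbergR (t : k) :
    IsGaussian (legGen (k := k) .x) (legGen .p)
      (heisenbergR t : PowerSeries (HeisenbergPow k 2)) (crossingGaussianMatrix (expT t)) := by
  refine isGaussian_gaussian ?_
  ext i j : 1
  fin_cases i <;> fin_cases j <;> simp [constantCoeff_expT]

theorem isGaussian_heisenbergR_zpow (t : k) (c : Crossing) :
    IsGaussian (legGen (k := k) .x) (legGen .p)
      ((heisenbergR t ^ c.sign : (PowerSeries (HeisenbergPow k 2))ˣ) :
        PowerSeries (HeisenbergPow k 2)) (crossingGaussianMatrix (expT t ^ c.sign)) := by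
  rw [Crossing.sign]
  split_ifs
  · rw [zpow_one, zpow_one]
    exact isGaussian_heisenbergR t
  · rw [zpow_neg_one, zpow_neg_one]
    exact (isGaussian_heisenbergR t).inv (crossingGaussianMatrix_mul_inv _)

namespace UpwardKnotDiagram

variable (D : UpwardKnotDiagram)

theorem edge_castSucc (e : Fin D.lastEdge) : D.edge e = e.castSucc := by
  ext
  simp [edge, Fin.ofNat, Nat.mod_eq_of_lt (Nat.lt_succ_of_lt e.2)]

theorem edge_succ (e : Fin D.lastEdge) : D.edge (e + 1) = e.succ := by
  ext
  simp [edge, Fin.ofNat, Nat.mod_eq_of_lt (Nat.succ_lt_succ e.2)]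

theorem edge_injOn {a b : ℕ} (ha : a < D.lastEdge) (hb : b < D.lastEdge)
    (h : D.edge a = D.edge b) : a = b := by
  have h1 := D.edge_castSucc ⟨a, ha⟩
  have h2 := D.edge_castSucc ⟨b, hb⟩
  simp only at h1 h2
  rw [h1, h2] at h
  simpa using h

/-- A crossing of a diagram does not involve the last edge, and its edges differ. -/
structure IsProperCrossing (c : Crossing) : Prop where
  over_lt : c.overEdge < D.lastEdge
  under_lt : c.underEdge < D.lastEdge
  ne : D.edge c.overEdge ≠ D.edge c.underEdge

theorem incomingEdges_perm :
    (incomingEdges D.tangle.crossings).Perm (List.range D.lastEdge) :=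
  D.incomingEdges_perm_and_exists_numbering.1

/-- All of this is read off from the incoming edges, which run through 0, …, `lastEdge` - 1 without
repetition. Distinct legs are what makes the placement of R an algebra homomorphism. -/
theorem isProperCrossing {c : Crossing} (hc : c ∈ D.tangle.crossings) : D.IsProperCrossing c := by
  have hmem (e : ℕ) (he : e ∈ [c.overEdge, c.underEdge]) : e < D.lastEdge :=
    List.mem_range.1 (D.incomingEdges_perm.subset (List.mem_flatMap.2 ⟨c, hc, he⟩))
  have hnd : (incomingEdges D.tangle.crossings).Nodup :=
    D.incomingEdges_perm.nodup_iff.2 List.nodup_range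
  have hne : c.overEdge ≠ c.underEdge := by
    have := (List.nodup_flatMap.1 hnd).1 c hc
    simpa using this
  have h1 := hmem c.overEdge (by simp)
  have h2 := hmem c.underEdge (by simp)
  exact ⟨h1, h2, fun h => hne (D.edge_injOn h1 h2 h)⟩

theorem sum_crossings {V : Type*} [AddCommMonoid V] (f : ℕ → V) :
    (D.tangle.crossings.map fun c => f c.overEdge + f c.underEdge).sum =
      ∑ e : Fin D.lastEdge, f e := by
  have h (cs : List Crossing) : (cs.map fun c => f c.overEdge + f c.underEdge).sum =
      ((incomingEdges cs).map f).sum := by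
    induction cs with
    | nil => rfl
    | cons c cs ih =>
      rw [List.map_cons, List.sum_cons, ih]
      simp [incomingEdges, add_assoc]
  rw [h, (D.incomingEdges_perm.map f).sum_eq, Fin.sum_univ_eq_sum_range f]
  rfl

/-- The legs of a crossing. -/
def legs (c : Crossing) : Fin 2 → D.Edge := ![D.edge c.overEdge, D.edge c.underEdge]

variable {D} in
theorem IsProperCrossing.legs_injective {c : Crossing} (hc : D.IsProperCrossing c) :
    Function.Injective (D.legs c) := by
  intro a b h
  fin_cases a <;> fin_cases b <;> simp_all [legs, hc.ne, hc.ne.symm]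

/-- The matrix of the bead of a crossing. -/
def beadMatrix (t : k) (c : Crossing) : Matrix D.Edge D.Edge (PowerSeries k) :=
  embedMatrix (D.legs c) (crossingGaussianMatrix (expT t ^ c.sign))

variable {D} in
theorem IsProperCrossing.isGaussian_crossingBead (t : k) {c : Crossing}
    (hc : D.IsProperCrossing c) :
    IsGaussian (legGen (k := k) .x) (legGen .p) (D.crossingBead (heisenbergR t) c)
      (D.beadMatrix t c) := by
  have h := (isGaussian_heisenbergR_zpow t c).map (f := placeLegsAlgHom hc.ne)
    (x := legGen .x) (p := legGen .p) hc.legs_injective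
    (fun a => placeLegsAlgHom_single hc.ne a _) (fun a => placeLegsAlgHom_single hc.ne a _)
    (fun l hl b => commute_placeLegsAlgHom hc.ne (fun h => hl ⟨0, h.symm⟩)
      (fun h => hl ⟨1, h.symm⟩) _ b)
    (fun l hl b => commute_placeLegsAlgHom hc.ne (fun h => hl ⟨0, h.symm⟩)
      (fun h => hl ⟨1, h.symm⟩) _ b)
  convert h using 1
  · ext d
    rw [crossingBead, deform, PowerSeries.coeff_mk, PowerSeries.coeff_map]
    rfl
  · rfl

/-- The product of the beads of all crossings. -/
def beadProduct (t : k) : PowerSeries (⨂[k] _ : D.Edge, Heisenberg k) :=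
  (D.tangle.crossings.map (D.crossingBead (heisenbergR t))).prod

/-- The matrix of the product of the beads of all crossings. -/
def beadProductMatrix (t : k) : Matrix D.Edge D.Edge (PowerSeries k) :=
  (D.tangle.crossings.map (D.beadMatrix t)).prod

theorem isGaussian_beadProduct (t : k) :
    IsGaussian (legGen (k := k) .x) (legGen .p) (D.beadProduct t) (D.beadProductMatrix t) :=
  IsGaussian.list_prod _ _ _ fun _ hc => (D.isProperCrossing hc).isGaussian_crossingBead t

/-- As κ = 1, the turns of the edges leave no trace. -/
theorem universalInvariant_eq (t : k) :
    D.universalInvariant (heisenbergR t) 1 =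
      deform (contractLegs (k := k) (A := Heisenberg k) (D.lastEdge + 1)) (D.beadProduct t) := by
  have h (e : D.Edge) : D.turnBead (k := k) (A := Heisenberg k) 1 e = 1 := by
    rw [turnBead, one_zpow, Units.val_one, deform_algHom, map_one]
  have h2 : List.ofFn (D.turnBead (k := k) (A := Heisenberg k) 1) =
      List.replicate (D.lastEdge + 1) 1 := by
    rw [← List.ofFn_const]
    exact congrArg List.ofFn (funext h)
  rw [universalInvariant, h2, List.prod_replicate, one_pow, mul_one]
  rfl

/-- The difference of the matrix of the bead of a crossing and the identity. -/
def beadDifference (t : k) (c : Crossing) : Matrix D.Edge D.Edge (PowerSeries k) :=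
  ∑ a, ∑ b, Matrix.single (D.legs c a) (D.legs c b)
    ((crossingGaussianMatrix (expT t ^ c.sign) - 1) a b)

/-- The differences of the bead matrices from 1 are supported on disjoint pairs of edges, so their
products vanish and the product of the matrices linearizes. -/
theorem beadProductMatrix_eq (t : k) :
    D.beadProductMatrix t = 1 + (D.tangle.crossings.map (D.beadDifference t)).sum := by
  have key (cs : List Crossing) (hcs : ∀ c ∈ cs, D.IsProperCrossing c)
      (hnd : (incomingEdges cs).Nodup) : (cs.map (D.beadMatrix t)).prod =
      1 + (cs.map (D.beadDifference t)).sum := by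
    induction cs with
    | nil => simp
    | cons c cs ih =>
      have hnd' := List.nodup_append.1 hnd
      rw [List.map_cons, List.prod_cons, ih (fun c' h => hcs c' (by simp [h])) hnd'.2.1,
        List.map_cons, List.sum_cons]
      have h0 : D.beadDifference t c * (cs.map (D.beadDifference t)).sum = 0 := by
        rw [← List.sum_map_mul_left]
        refine List.sum_eq_zero fun M hM => ?_
        obtain ⟨c', hc', rfl⟩ := List.mem_map.1 hM
        have hne (a b : Fin 2) : D.legs c a ≠ D.legs c' b := by
          have hlt (c'' : Crossing) (h : D.IsProperCrossing c'') (a : Fin 2) :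
              ∃ e ∈ [c''.overEdge, c''.underEdge], e < D.lastEdge ∧ D.legs c'' a = D.edge e := by
            fin_cases a
            · exact ⟨_, by simp, h.over_lt, rfl⟩
            · exact ⟨_, by simp, h.under_lt, rfl⟩
          obtain ⟨e, he, he1, he2⟩ := hlt c (hcs c (by simp)) a
          obtain ⟨e', he', he1', he2'⟩ := hlt c' (hcs c' (by simp [hc'])) b
          rw [he2, he2']
          intro h
          exact hnd'.2.2 e he e' (List.mem_flatMap.2 ⟨c', hc', he'⟩) (D.edge_injOn he1 he1' h)
        simp only [beadDifference, Finset.sum_mul, Finset.mul_sum]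
        refine Finset.sum_eq_zero fun _ _ => Finset.sum_eq_zero fun _ _ =>
          Finset.sum_eq_zero fun _ _ => Finset.sum_eq_zero fun _ _ => ?_
        exact Matrix.single_mul_single_of_ne _ _ _ _ (hne _ _) _
      rw [beadMatrix, embedMatrix, ← beadDifference, add_mul, one_mul, mul_add, mul_one, h0]
      abel
  exact key _ (fun c hc => D.isProperCrossing hc)
    (D.incomingEdges_perm.nodup_iff.2 List.nodup_range)

/-- The last edge enters no crossing, so its leg carries no bead. -/
theorem beadProductMatrix_last (t : k) (j : D.Edge) :
    D.beadProductMatrix t (Fin.last D.lastEdge) j = if j = Fin.last D.lastEdge then 1 else 0 := by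
  have h : (D.tangle.crossings.map (D.beadDifference t)).sum (Fin.last D.lastEdge) j = 0 := by
    have h1 : (D.tangle.crossings.map (D.beadDifference t)).sum (Fin.last D.lastEdge) j =
        (D.tangle.crossings.map fun c =>
          D.beadDifference t c (Fin.last D.lastEdge) j).sum := by
      induction D.tangle.crossings with
      | nil => rfl
      | cons c cs ih =>
        rw [List.map_cons, List.sum_cons, Matrix.add_apply, ih, List.map_cons, List.sum_cons]
    rw [h1]
    refine List.sum_eq_zero fun z hz => ?_
    obtain ⟨c, hc, rfl⟩ := List.mem_map.1 hz
    have hp := D.isProperCrossing hc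
    have hne (a : Fin 2) : D.legs c a ≠ Fin.last D.lastEdge := by
      fin_cases a
      · exact (D.edge_castSucc ⟨_, hp.over_lt⟩).trans_ne (Fin.castSucc_ne_last _)
      · exact (D.edge_castSucc ⟨_, hp.under_lt⟩).trans_ne (Fin.castSucc_ne_last _)
    simp [beadDifference, Matrix.sum_apply, hne]
  rw [beadProductMatrix_eq, Matrix.add_apply, h, add_zero, Matrix.one_apply]
  simp [eq_comm]

/-- The contribution of a crossing to the matrix that is obtained by contracting the beads. -/
def contractedCrossing (t : k) (c : Crossing) : Matrix D.Edge D.Edge (PowerSeries k) :=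
  Matrix.single (D.edge c.overEdge) (D.edge (c.overEdge + 1))
      ((expT t ^ c.sign : (PowerSeries k)ˣ) : PowerSeries k) +
    Matrix.single (D.edge c.overEdge) (D.edge (c.underEdge + 1))
      (1 - ((expT t ^ c.sign : (PowerSeries k)ˣ) : PowerSeries k) ^ 2) +
    Matrix.single (D.edge c.underEdge) (D.edge (c.underEdge + 1))
      ((expT t ^ c.sign : (PowerSeries k)ˣ) : PowerSeries k)

omit [CharZero k] in
theorem single_mul_shiftMatrix (i : D.Edge) {e : ℕ} (he : e < D.lastEdge) (v : PowerSeries k) :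
    Matrix.single i (D.edge e) v * shiftMatrix k D.lastEdge =
      Matrix.single i (D.edge (e + 1)) v := by
  have h1 := D.edge_castSucc ⟨e, he⟩
  have h2 := D.edge_succ ⟨e, he⟩
  simp only at h1 h2
  rw [shiftMatrix, Finset.mul_sum, Finset.sum_eq_single ⟨e, he⟩, h1, h2,
    Matrix.single_mul_single_same, mul_one]
  · intro b _ hb
    rw [h1]
    exact Matrix.single_mul_single_of_ne _ _ _ _ (fun h => hb (Fin.castSucc_injective _ h).symm) _
  · simp

theorem contractionMatrix_beadProductMatrix (t : k) :
    contractionMatrix (D.beadProductMatrix t) =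
      1 - (D.tangle.crossings.map (D.contractedCrossing t)).sum := by
  have hS : shiftMatrix k D.lastEdge = (D.tangle.crossings.map fun c =>
      Matrix.single (D.edge c.overEdge) (D.edge (c.overEdge + 1)) (1 : PowerSeries k) +
      Matrix.single (D.edge c.underEdge) (D.edge (c.underEdge + 1)) 1).sum := by
    rw [D.sum_crossings fun e => Matrix.single (D.edge e) (D.edge (e + 1)) (1 : PowerSeries k),
      shiftMatrix]
    simp only [edge_castSucc, edge_succ]
  rw [contractionMatrix, beadProductMatrix_eq, Matrix.transpose_add, Matrix.transpose_one, add_mul,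
    one_mul, Matrix.transpose_list_sum, List.map_map, ← List.sum_map_mul_right]
  congr 1
  -- Only the shift from the identity part of Q is distributed over the crossings; there its entries
  -- 1 turn the entries u - 1 of the bead into u.
  nth_rewrite 1 [hS]
  rw [← List.sum_map_add]
  congr 1
  refine List.map_congr_left fun c hc => ?_
  have hp := D.isProperCrossing hc
  set u : PowerSeries k := ((expT t ^ c.sign : (PowerSeries k)ˣ) : PowerSeries k) with hu
  have hd : (D.beadDifference t c).transpose * shiftMatrix k D.lastEdge =
      Matrix.single (D.edge c.overEdge) (D.edge (c.overEdge + 1)) (u - 1) +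
      Matrix.single (D.edge c.overEdge) (D.edge (c.underEdge + 1)) (1 - u ^ 2) +
      Matrix.single (D.edge c.underEdge) (D.edge (c.underEdge + 1)) (u - 1) := by
    simp only [beadDifference, Fin.sum_univ_two, legs, Matrix.cons_val_zero, Matrix.cons_val_one,
      Matrix.sub_apply, crossingGaussianMatrix, Matrix.of_apply, ← hu, Matrix.one_apply_eq,
      Matrix.one_apply_ne, Fin.zero_ne_one, one_ne_zero, Ne, not_false_eq_true, sub_zero,
      Matrix.single_zero, add_zero, Matrix.transpose_add, Matrix.transpose_single, add_mul,
      D.single_mul_shiftMatrix _ hp.over_lt, D.single_mul_shiftMatrix _ hp.under_lt, add_assoc]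
  rw [Function.comp_apply, hd, contractedCrossing, ← hu]
  have hv (i j : D.Edge) : Matrix.single i j u =
      Matrix.single i j 1 + Matrix.single i j (u - 1) := by
    rw [← Matrix.single_add, add_sub_cancel]
  rw [hv, hv]
  abel

/-- Evaluation of Laurent polynomials at `T²`. -/
def evalSq (t : k) : LaurentPolynomial ℤ →+* PowerSeries k :=
  LaurentPolynomial.eval₂ (Int.castRingHom (PowerSeries k)) (expT t ^ 2)

theorem diagonal_mul_single_mul_diagonal {R ι : Type*} [CommRing R] [Fintype ι] [DecidableEq ι]
    (d e : ι → R) (i j : ι) (v : R) :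
    Matrix.diagonal d * Matrix.single i j v * Matrix.diagonal e =
      Matrix.single i j (d i * v * e j) := by
  ext a b : 1
  rw [Matrix.mul_diagonal, Matrix.diagonal_mul, Matrix.single_apply, Matrix.single_apply]
  split_ifs with h
  · rw [h.1, h.2]
  · simp

/-- The witness is d_e = T^μ(e), with μ the Alexander numbering; its values at both ends are 1
because both end edges have the unbounded region of index 0 to their left. -/
theorem exists_vector (t : k) : ∃ d : D.Edge → (PowerSeries k)ˣ, d 0 = 1 ∧
    (∀ c ∈ D.tangle.crossings,
      d (D.edge (c.underEdge + 1)) = d (D.edge c.overEdge) ∧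
      d (D.edge (c.overEdge + 1)) = d (D.edge c.underEdge) ∧
      d (D.edge c.overEdge) = d (D.edge c.underEdge) * expT t ^ c.sign) ∧
    d (Fin.last D.lastEdge) = 1 := by
  obtain ⟨-, μ, h0, hl, hμ⟩ := D.incomingEdges_perm_and_exists_numbering
  have hval (e : ℕ) (he : e ≤ D.lastEdge) : (D.edge e : ℕ) = e :=
    Nat.mod_eq_of_lt (Nat.lt_succ_of_le he)
  refine ⟨fun e => expT t ^ μ e, by simp [h0], fun c hc => ?_, by simp [hl]⟩
  have hp := D.isProperCrossing hc
  obtain ⟨h1, h2, h3⟩ := hμ c hc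
  simp only [hval _ hp.over_lt, hval _ hp.under_lt, hval _ hp.over_lt.le, hval _ hp.under_lt.le, h1,
    h2, ← zpow_add, ← h3, add_sub_cancel, and_self]

/-- With u = T^s the entries -u, u² - 1, -u of B become -u², u² - 1, -1: conjugation multiplies them
by d_over / d_under = u, by 1, and by u⁻¹. -/
theorem alexanderMatrix_map_evalSq (t : k) {d : D.Edge → (PowerSeries k)ˣ}
    (hd : ∀ c ∈ D.tangle.crossings,
      d (D.edge (c.underEdge + 1)) = d (D.edge c.overEdge) ∧
      d (D.edge (c.overEdge + 1)) = d (D.edge c.underEdge) ∧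
      d (D.edge c.overEdge) = d (D.edge c.underEdge) * expT t ^ c.sign) :
    D.alexanderMatrix.map (evalSq t) =
      Matrix.diagonal (fun e => (d e : PowerSeries k)) *
        contractionMatrix (D.beadProductMatrix t) *
          Matrix.diagonal (fun e => (↑(d e)⁻¹ : PowerSeries k)) := by
  have h1 : Matrix.diagonal (fun e => (d e : PowerSeries k)) *
      Matrix.diagonal (fun e => (↑(d e)⁻¹ : PowerSeries k)) = 1 := by
    rw [Matrix.diagonal_mul_diagonal]
    simp
  rw [contractionMatrix_beadProductMatrix, mul_sub, mul_one, sub_mul, h1, alexanderMatrix,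
    ← RingHom.mapMatrix_apply, map_add, map_one, map_list_sum, List.map_map,
    ← List.sum_map_mul_left, ← List.sum_map_mul_right, sub_eq_add_neg,
    ← neg_one_mul, ← List.sum_map_mul_left]
  congr 2
  refine List.map_congr_left fun c hc => ?_
  obtain ⟨h2, h3, h4⟩ := hd c hc
  simp only [Function.comp_apply, neg_one_mul, contractedCrossing, mul_add, add_mul,
    diagonal_mul_single_mul_diagonal, crossingMatrix, map_add, RingHom.mapMatrix_apply,
    Matrix.map_single, Matrix.single_neg, h2, h3]
  have hT : evalSq t (LaurentPolynomial.T c.sign) =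
      ((expT t ^ c.sign : (PowerSeries k)ˣ) : PowerSeries k) ^ 2 := by
    rw [evalSq, LaurentPolynomial.eval₂_T, ← Units.val_pow_eq_pow_val, ← zpow_natCast,
      ← zpow_natCast, ← zpow_mul, ← zpow_mul, mul_comm]
  have h5 : (d (D.edge c.overEdge) : PowerSeries k) = d (D.edge c.underEdge) *
      ((expT t ^ c.sign : (PowerSeries k)ˣ) : PowerSeries k) := by rw [h4, Units.val_mul]
  have h6 := (d (D.edge c.overEdge)).mul_inv
  have h7 := (d (D.edge c.underEdge)).mul_inv
  rw [map_neg, map_sub, map_neg, map_one, hT]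
  set u : PowerSeries k := ((expT t ^ c.sign : (PowerSeries k)ˣ) : PowerSeries k)
  congr 3
  · linear_combination u * (↑(d (D.edge c.underEdge))⁻¹ : PowerSeries k) * h5 + u ^ 2 * h7
  · linear_combination (1 - u ^ 2) * h6
  · linear_combination -h6 + (↑(d (D.edge c.overEdge))⁻¹ : PowerSeries k) * h5

end UpwardKnotDiagram

end UniversalInvariantComputation

/-! ### The universal invariant is a scalar, and its value -/

section MainTheorem

variable {k : Type*} [Field k] [CharZero k]

namespace UpwardKnotDiagram

variable (D : UpwardKnotDiagram)

theorem contractedCrossing_mulVec (t : k) {d : D.Edge → (PowerSeries k)ˣ} {c : Crossing}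
    (hd : d (D.edge (c.underEdge + 1)) = d (D.edge c.overEdge) ∧
      d (D.edge (c.overEdge + 1)) = d (D.edge c.underEdge) ∧
      d (D.edge c.overEdge) = d (D.edge c.underEdge) * expT t ^ c.sign) :
    (D.contractedCrossing t c).mulVec (fun e => (↑(d e)⁻¹ : PowerSeries k)) =
      Pi.single (D.edge c.overEdge) (↑(d (D.edge c.overEdge))⁻¹ : PowerSeries k) +
        Pi.single (D.edge c.underEdge) (↑(d (D.edge c.underEdge))⁻¹ : PowerSeries k) := by
  obtain ⟨h1, h2, h3⟩ := hd
  have h4 : ((expT t ^ c.sign : (PowerSeries k)ˣ) : PowerSeries k) *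
      (↑(d (D.edge c.overEdge))⁻¹ : PowerSeries k) = (↑(d (D.edge c.underEdge))⁻¹ : PowerSeries k) := by
    rw [← Units.val_mul, h3, mul_inv_rev, mul_inv_cancel_left]
  have hs (i j : D.Edge) (v : PowerSeries k) (w : D.Edge → PowerSeries k) :
      (Matrix.single i j v).mulVec w = Pi.single i (v * w j) := by
    rw [Matrix.single_mulVec]
    rfl
  rw [contractedCrossing, Matrix.add_mulVec, Matrix.add_mulVec, hs, hs, hs, ← Pi.single_add, h1, h2,
    h4]
  congr 2
  rw [← h4]
  ring

/-- In terms of the Alexander matrix, the rows of an over-edge, 1 - T^s + (T^s - 1), and of an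
under-edge, 1 - 1, sum to zero. Only the row of the last edge, which enters no crossing, sums to 1.
-/
theorem contractionMatrix_mulVec (t : k) {d : D.Edge → (PowerSeries k)ˣ}
    (hd : ∀ c ∈ D.tangle.crossings,
      d (D.edge (c.underEdge + 1)) = d (D.edge c.overEdge) ∧
      d (D.edge (c.overEdge + 1)) = d (D.edge c.underEdge) ∧
      d (D.edge c.overEdge) = d (D.edge c.underEdge) * expT t ^ c.sign) :
    (contractionMatrix (D.beadProductMatrix t)).mulVec (fun e => (↑(d e)⁻¹ : PowerSeries k)) =
      Pi.single (Fin.last D.lastEdge) (↑(d (Fin.last D.lastEdge))⁻¹ : PowerSeries k) := by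
  set v : D.Edge → PowerSeries k := fun e => (↑(d e)⁻¹ : PowerSeries k) with hv
  have hsum : (D.tangle.crossings.map (D.contractedCrossing t)).sum.mulVec v =
      ∑ e : Fin D.lastEdge, Pi.single e.castSucc (v e.castSucc) := by
    have h1 := D.sum_crossings fun e => (Pi.single (D.edge e) (v (D.edge e)) : D.Edge → PowerSeries k)
    simp only [edge_castSucc] at h1
    rw [← h1, ← List.map_congr_left fun c hc => D.contractedCrossing_mulVec t (hd c hc)]
    exact (map_list_sum (Matrix.mulVecBilin (PowerSeries k) (PowerSeries k) |>.flip v) _).trans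
      (by rw [List.map_map]; rfl)
  have h2 : v = (∑ e : Fin D.lastEdge, Pi.single e.castSucc (v e.castSucc)) +
      Pi.single (Fin.last D.lastEdge) (v (Fin.last D.lastEdge)) := by
    rw [← Fin.sum_univ_castSucc fun e => (Pi.single e (v e) : D.Edge → PowerSeries k)]
    exact (Finset.univ_sum_single v).symm
  rw [contractionMatrix_beadProductMatrix, Matrix.sub_mulVec, Matrix.one_mulVec, hsum,
    sub_eq_iff_eq_add', ← h2]

theorem evalSq_alexanderPolynomial (t : k) :
    evalSq t D.alexanderPolynomial = (contractionMatrix (D.beadProductMatrix t)).det := by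
  obtain ⟨d, -, hd, -⟩ := D.exists_vector t
  rw [alexanderPolynomial, RingHom.map_det, RingHom.mapMatrix_apply,
    D.alexanderMatrix_map_evalSq t hd, Matrix.det_mul_right_comm, Matrix.diagonal_mul_diagonal]
  simp

theorem commute_universalInvariant (t : k) (g : HeisenbergGen) :
    Commute (PowerSeries.C (heisenbergGen g)) (D.universalInvariant (heisenbergR t) 1) := by
  obtain ⟨d, h0, hd, hl⟩ := D.exists_vector t
  have he (i : D.Edge) : ∑ j, contractionMatrix (D.beadProductMatrix t) i j *
      (↑(d j)⁻¹ : PowerSeries k) = if i = Fin.last D.lastEdge then 1 else 0 := by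
    have h := congrFun (D.contractionMatrix_mulVec t hd) i
    rw [hl, Pi.single_apply, inv_one, Units.val_one] at h
    exact h
  rw [universalInvariant_eq]
  cases g with
  | x =>
    exact (D.isGaussian_beadProduct t).commute_x (isContraction_contractLegs _ _)
      (D.beadProductMatrix_last t) (by simp [h0]) he
  | p =>
    exact (D.isGaussian_beadProduct t).commute_p (isContraction_contractLegs _ _)
      (D.beadProductMatrix_last t) (by simp [h0]) he

theorem universalInvariant_eq_map (t : k) :
    D.universalInvariant (heisenbergR t) 1 = PowerSeries.map (algebraMap k (Heisenberg k))
      (deform vacuum (D.universalInvariant (heisenbergR t) 1)) := by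
  ext d
  rw [PowerSeries.coeff_map, coeff_deform]
  refine eq_algebraMap_vacuum_of_commute fun g => ?_
  have h := congrArg (PowerSeries.coeff d) (D.commute_universalInvariant t g).eq
  rwa [PowerSeries.coeff_C_mul, PowerSeries.coeff_mul_C] at h

theorem vacuum_universalInvariant_mul (t : k) :
    deform vacuum (D.universalInvariant (heisenbergR t) 1) * evalSq t D.alexanderPolynomial = 1 := by
  rw [evalSq_alexanderPolynomial, universalInvariant_eq]
  exact (D.isGaussian_beadProduct t).functional_mul_det (isContraction_contractLegs _ _)
    legGen_p_mul_x vacuum_x_mul (by rw [contractLegs_map_one, vacuum_one])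

end UpwardKnotDiagram

omit [CharZero k] in
-- The quadratic form has no constant term in x and p, so only the summand 1 of the exponential
-- survives. This makes the scalar part unique.
theorem vacuum_gaussian (Q : Matrix (Fin 1) (Fin 1) (PowerSeries k)) :
    deform vacuum (deform (contractLegs 1) (gaussian Q)) = 1 := by
  set q := quadraticForm (Q - 1) with hq
  have h0 : PowerSeries.map (MvPolynomial.constantCoeff (R := k) (σ := Fin 1 ⊕ Fin 1)) q = 0 := by
    simp [hq, quadraticForm]
  ext d
  have h1 : PowerSeries.coeff d (deform vacuum (deform (contractLegs 1) (gaussian Q))) =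
      vacuum (normalOrderOne (PowerSeries.coeff d (hexp (k := k) q))) := by
    rw [gaussian, deform, deform, deform, PowerSeries.coeff_mk, PowerSeries.coeff_mk,
      PowerSeries.coeff_mk]
    rfl
  rw [h1, vacuum_normalOrderOne, hexp, PowerSeries.coeff_mk, map_sum, Finset.sum_range_succ',
    Finset.sum_eq_zero]
  · simp [PowerSeries.coeff_one, apply_ite]
  · intro m _
    rw [MvPolynomial.smul_eq_C_mul, map_mul, ← PowerSeries.coeff_map, map_pow, h0,
      zero_pow m.succ_ne_zero, map_zero, mul_zero]

omit [CharZero k] in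
theorem one_mem_expMatrices (n : ℕ) : 1 ∈ expMatrices k n := by
  refine ⟨0, ?_⟩
  ext i j d
  rw [matrixExp, Matrix.of_apply, PowerSeries.coeff_mk, Finset.sum_range_succ',
    Finset.sum_eq_zero]
  · simp
  · intro m _
    simp

omit [CharZero k] in
theorem IsScalarPart.eq_vacuum {Z : PowerSeries (Heisenberg k)} {ω : PowerSeries k}
    (h : IsScalarPart Z ω) : ω = deform vacuum Z := by
  obtain ⟨Q, -, rfl⟩ := h
  rw [← smul_eq_map_mul, deform_functional_smul, vacuum_gaussian, mul_one]

omit [CharZero k] in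
theorem isScalarPart_map (ω : PowerSeries k) :
    IsScalarPart (PowerSeries.map (algebraMap k (Heisenberg k)) ω) ω := by
  refine ⟨1, one_mem_expMatrices 1, ?_⟩
  have h : deform (contractLegs 1) (gaussian (1 : Matrix (Fin 1) (Fin 1) (PowerSeries k))) =
      (1 : PowerSeries (Heisenberg k)) := by
    rw [gaussian_one, ← map_one PowerSeries.C]
    exact (deform_C _ _).trans (congrArg PowerSeries.C (contractLegs_map_one 1))
  rw [h, mul_one]

end MainTheorem

theorem mainTheorem1 {k : Type*} [Field k] [CharZero k] (t : k) (D : UpwardKnotDiagram) :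
    (∃! ω : PowerSeries k, IsScalarPart (D.universalInvariant (heisenbergR t) 1) ω) ∧
    ∀ ω : PowerSeries k, IsScalarPart (D.universalInvariant (heisenbergR t) 1) ω →
      ∃ (ε : ℤˣ) (n : ℤ),
        ω * LaurentPolynomial.eval₂ (Int.castRingHom (PowerSeries k)) (expT t ^ 2)
            D.alexanderPolynomial =
          ((ε : ℤ) : PowerSeries k) * ((expT t ^ n : (PowerSeries k)ˣ) : PowerSeries k) := by
  -- The unit is 1: the conjugation of the matrices gives equality of the determinants for every
  -- diagram.
  refine ⟨⟨deform vacuum (D.universalInvariant (heisenbergR t) 1), ?_,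
    fun ω hω => hω.eq_vacuum⟩, fun ω hω => ⟨1, 0, ?_⟩⟩
  · have h := isScalarPart_map (deform vacuum (D.universalInvariant (heisenbergR t) 1))
    rwa [← D.universalInvariant_eq_map t] at h
  · rw [hω.eq_vacuum]
    rw [zpow_zero, Units.val_one, Units.val_one, Int.cast_one, mul_one]
    exact D.vacuum_universalInvariant_mul t

end
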